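/- Let $d\ge 1$ and let $Y$ be the continuous-time multitype birth and death process on $\mathbb N^d=E\cup\{\partial\}$, $\mathbb N=\{0,1,2,\dots\}$, $\partial=(0,\dots,0)$, with jump rates $b_i(x)$ from $x$ to $x+e_i$, $d_i(x)$ from $x$ to $x-e_i$, and $0$ otherwise, where $b_i(x)>0$ for all $x\in E$ and $b_i(\partial)=0$ (so that $\partial$ is absorbing), and $d_i(x)>0$ if $x_i\ge 1$, $d_i(x)=0$ if $x_i=0$. Write $|x|=x_1+\dots+x_d$. Let $\kappa(x)$, $x\in E$, be the jump rate of $Y$ from $x$ to $\partial$, and let $X$ be the Markov chain on $E$ obtained by suppressing the jumps of $Y$ to $\partial$ (so $Y$ is $X$ killed at rate $\kappa$). Both are the minimal chains with the given rates. For functions $V,U:E\to\mathbb R$, say that $V$ is in the extended domain of the generator of $X$, with $LV=U$, if for all $x\in E$ and $t\ge 0$ one has $\mathbb E_x|V(X_t)|<\infty$, $\int_0^t\mathbb E_x|U(X_s)|\,ds<\infty$ and $$\mathbb E_x V(X_t)=V(x)+\int_0^t\mathbb E_xU(X_s)\,ds .$$ Say that this holds in the local sense if for every finite $K\subset E$ the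 same is true of the chain stopped when it leaves $K$, with $\mathbf 1_KU$ in place of $U$. Say that $(V,U)$ satisfies the Lyapunov condition if $V\ge 1$, $V$ is locally bounded with relatively compact level sets $\{V\le c\}$, and $U\le-\lambda_1V+C$ on $E$ for some constants $C$ and $\lambda_1>\|\kappa\|_\infty$. Assumption H is the following: $X$ and $Y$ do not explode, $\kappa$ is bounded, and 1. every nonempty compact (i.e. finite) $K\subset E$ is a small set for $X$: there are $t_K>0$, $\alpha_K>0$ and a probability measure $\nu_K$ on $K$ with $\mathbb P_x(X_{t_K}\in A)\ge\alpha_K\nu_K(A\cap K)$ for all $x\in K$, $A\subset E$; 2. there is a function $V$ in the extended domain of the generator of $X$ such that $(V,LV)$ satisfies the Lyapunov condition; 3. for every nonempty compact $K\subset E$, $\displaystyle\inf_{t\ge0}\frac{\inf_{x\in K}\mathbb P_x(Y_t\ne\partial)}{\sup_{x\in K}\mathbb P_x(Y_t\neq\partial)}>0$. **Proposition.** (a) If $\frac1{|x|}\sum_{i=1}^d\big(d_i(x)-b_i(x)\big)\to+\infty$ when $|x|\to+\infty$, then Assumption H is satisfied; moreover $V(x)=|x|$ is in the extended domain of the generator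 of $X$ in the local sense and $(V,LV)$ satisfies the Lyapunov condition. (b) If, for some $\delta>1$, $\sum_{i=1}^d\big(d_i(x)-\delta\,b_i(x)\big)\to+\infty$ when $|x|\to+\infty$, then Assumption H is satisfied; moreover, for all sufficiently small $\varepsilon>0$, $V(x)=\exp(\varepsilon|x|)$ is in the extended domain of the generator of $X$ and $(V,LV)$ satisfies the Lyapunov condition. -/

import Mathlib

open MeasureTheory Filter Set
open scoped ENNReal NNReal Topology

noncomputable section

/-- Conservative, totally stable jump rates `q(x,y)`, `y ≠ x`, on a set `S`. -/
structure JumpRates (S : Type) where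
  rate : S → S → ℝ≥0
  rate_self : ∀ x, rate x x = 0
  summable_rate : ∀ x, Summable (rate x)

namespace JumpRates

variable {S : Type}

/-- The total jump rate out of `x`. -/
def exitRate (q : JumpRates S) (x : S) : ℝ≥0 := ∑' y, q.rate x y

open Classical in
/-- The probability that the jump process with rates `q`, started at `x`, is at `y` at time `t`
after at most `n - 1` jumps (conditioning on the time `s` and the target `z` of the first jump). -/
def transAux (q : JumpRates S) : ℕ → ℝ → S → S → ℝ≥0∞
  | 0, _, _, _ => 0
  | n + 1, t, x, y =>
      (if x = y then ENNReal.ofReal (Real.exp (-(q.exitRate x : ℝ) * t)) else 0) +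
        ∫⁻ s in Set.Icc (0 : ℝ) t, ENNReal.ofReal (Real.exp (-(q.exitRate x : ℝ) * s)) *
          ∑' z, (q.rate x z : ℝ≥0∞) * transAux q n (t - s) z y

/-- The transition function `p_t(x,y)`, `t ≥ 0`, of the (minimal) continuous-time Markov chain with
rates `q`, i.e. the minimal nonnegative solution of the backward Kolmogorov equation. -/
def trans (q : JumpRates S) (t : ℝ) (x y : S) : ℝ≥0∞ := ⨆ n, q.transAux n t x y

/-- The law at time `t` of the chain started at `x`; the missing mass, if any, is the probability
of an explosion before time `t`. -/
def law [MeasurableSpace S] (q : JumpRates S) (t : ℝ) (x : S) : Measure S :=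
  Measure.sum fun y => q.trans t x y • Measure.dirac y

/-- The chain almost surely does not explode, from any starting point. -/
def NonExplosive [MeasurableSpace S] (q : JumpRates S) : Prop :=
  ∀ t : ℝ, 0 ≤ t → ∀ x, IsProbabilityMeasure (q.law t x)

open Classical in
/-- The rates of the chain stopped when it leaves `K`: points outside `K` are made absorbing. -/
def stopped (q : JumpRates S) (K : Set S) : JumpRates S where
  rate x y := if x ∈ K then q.rate x y else 0
  rate_self x := by simp [q.rate_self]
  summable_rate x := by
    by_cases h : x ∈ K
    · simpa [h] using q.summable_rate x
    · simp [h]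

/-- For a chain `Y` on `E ∪ {∂}` with rates `q`: the rates on `E` of the chain `X` obtained from
`Y` by suppressing the jumps to `∂`. -/
def unkilled (q : JumpRates S) (pt : S) : JumpRates {x : S // x ≠ pt} where
  rate x y := q.rate x y
  rate_self x := q.rate_self x
  summable_rate x := NNReal.summable_comp_injective (q.summable_rate x) Subtype.val_injective

/-- For a chain `Y` on `E ∪ {∂}` with rates `q`: the killing rate `κ` on `E`. Thus `Y` is `X` sent
to `∂` at rate `κ(X)`. -/
def killing (q : JumpRates S) (pt : S) (x : {x : S // x ≠ pt}) : ℝ≥0 := q.rate x pt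

end JumpRates

section General

variable {E : Type} [MeasurableSpace E]

/-- `K` is a small set for the Markov process with transition laws `P t x`. -/
def IsSmallSet (P : ℝ → E → Measure E) (K : Set E) : Prop :=
  ∃ t : ℝ, 0 < t ∧ ∃ α : ℝ≥0, 0 < α ∧ ∃ ν : Measure E, IsProbabilityMeasure ν ∧ ν Kᶜ = 0 ∧
    ∀ x ∈ K, ∀ A : Set E, MeasurableSet A → (α : ℝ≥0∞) * ν (A ∩ K) ≤ P t x A

/-- `V` is in the extended domain of the generator `L` of the Markov process with transition laws
`P t x`, and `LV = U` (extended generator in the sense of Meyn and Tweedie):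
`E_x[V(X_t)] = V(x) + E_x[∫₀ᵗ U(X_s) ds]`, both expectations being absolutely convergent. -/
structure InExtendedDomain (P : ℝ → E → Measure E) (V U : E → ℝ) : Prop where
  measurable_left : Measurable V
  measurable_right : Measurable U
  integrable_left : ∀ x, ∀ t : ℝ, 0 ≤ t → Integrable V (P t x)
  integrable_right : ∀ x, ∀ t : ℝ, 0 ≤ t →
    ∫⁻ s in Set.Icc (0 : ℝ) t, ∫⁻ y, ENNReal.ofReal |U y| ∂(P s x) < ∞
  dynkin : ∀ x, ∀ t : ℝ, 0 ≤ t →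
    ∫ y, V y ∂(P t x) = V x + ∫ s in (0 : ℝ)..t, ∫ y, U y ∂(P s x)

/-- Localised version of `InExtendedDomain` for a chain: for every compact `K`, the identity holds
for the chain stopped when it leaves `K`, that is,
`E_x[V(X_{t ∧ T_K})] = V(x) + E_x[∫₀^{t ∧ T_K} U(X_s) ds]`. -/
def InLocalExtendedDomain [TopologicalSpace E] (q : JumpRates E) (V U : E → ℝ) : Prop :=
  ∀ K : Set E, IsCompact K → InExtendedDomain (q.stopped K).law V (K.indicator U)

/-- `V : E → [1,∞)` is locally bounded, has relatively compact level sets, and `U ≤ -λ₁ V + C` for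
some constants `C` and `λ₁ > ‖κ‖_∞`. -/
structure LyapunovBound [TopologicalSpace E] (κ : E → ℝ≥0) (V U : E → ℝ) : Prop where
  one_le : ∀ x, 1 ≤ V x
  locally_bounded : ∀ x, ∃ s ∈ 𝓝 x, BddAbove (V '' s)
  level_sets : ∀ c : ℝ, IsCompact (closure {x | V x ≤ c})
  drift : ∃ lam C : ℝ, ((⨆ x, κ x : ℝ≥0) : ℝ) < lam ∧ ∀ x, U x ≤ -lam * V x + C

end General

/-- Assumption H for the chain `Y` on `E ∪ {∂}` with jump rates `q`, where `∂ = pt` and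
`E = {x // x ≠ pt}`: `X` is the chain on `E` with rates `q.unkilled pt`, and `Y` is `X` killed at
rate `κ = q.killing pt`. The first four fields say that one is in the general setting: `∂` is
absorbing, `X` and `Y` are defined for all times, and `κ` is bounded. -/
structure AssumptionH {S : Type} [TopologicalSpace S] [MeasurableSpace S]
    (q : JumpRates S) (pt : S) : Prop where
  absorbing : ∀ y, q.rate pt y = 0
  nonExplosive : q.NonExplosive
  nonExplosive_unkilled : (q.unkilled pt).NonExplosive
  killing_bounded : BddAbove (Set.range (q.killing pt))
  small_sets : ∀ K : Set {x : S // x ≠ pt}, IsCompact K → K.Nonempty →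
    IsSmallSet (q.unkilled pt).law K
  lyapunov : ∃ V U : {x : S // x ≠ pt} → ℝ,
    InExtendedDomain (q.unkilled pt).law V U ∧ LyapunovBound (q.killing pt) V U
  survival : ∀ K : Set {x : S // x ≠ pt}, IsCompact K → K.Nonempty →
    0 < ⨅ t : {t : ℝ // 0 ≤ t},
      (⨅ x : K, q.law t.1 x.1.1 {pt}ᶜ) / (⨆ x : K, q.law t.1 x.1.1 {pt}ᶜ)

/-- `|x| = x_1 + ... + x_d` for `x ∈ ℕ^d`. -/
def size {d : ℕ} (x : Fin d → ℕ) : ℕ := ∑ i, x i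

/-- The rates of the multitype birth and death process on `ℕ^d`: `b_i(x)` from `x` to `x + e_i`,
`m_i(x)` from `x` to `x - e_i` (if `x_i ≥ 1`), and `0` otherwise. -/
def birthDeath {d : ℕ} (b m : Fin d → (Fin d → ℕ) → ℝ≥0) : JumpRates (Fin d → ℕ) where
  rate x y := ∑ i, ((if y = x + Pi.single i 1 then b i x else 0) +
    (if x = y + Pi.single i 1 then m i x else 0))
  rate_self x := by
    have h : ∀ i : Fin d, x ≠ x + Pi.single i 1 := fun i hi => by
      have := congrFun hi i
      simp at this
    exact Finset.sum_eq_zero fun i _ => by simp [h i]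
  summable_rate x := by
    refine summable_sum fun i _ => Summable.add ?_ ?_
    · refine summable_of_hasFiniteSupport ((Set.finite_singleton (x + Pi.single i 1)).subset ?_)
      intro y hy
      by_contra h
      exact hy (if_neg h)
    · refine summable_of_hasFiniteSupport ((Set.finite_singleton (x - Pi.single i 1)).subset ?_)
      intro y hy
      by_contra h
      refine hy (if_neg fun h' => h ?_)
      simp [h']

end

/-!
Everything is derived from the backward equation that defines the minimal transition function;
no sample paths are constructed.

Condition on the first jump. For a terminal reward `f` and a running reward `g`, both nonnegative,
the expected reward `E_x[f(X_t)] + E_x[∫₀ᵗ g(X_s) ds]` is a solution of the backward equation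
(`backward_reward`) and lies below all its nonnegative supersolutions (`reward_le`). If
`L f = U⁺ - U⁻`, then `f + E_x[∫₀ᵗ U⁺(X_s) ds]` is another solution of the equation with rewards
`f` and `U⁻`. Dynkin's formula says that the two solutions agree. Minimality gives one inequality.
The other one is the maximum principle `comparison`: if some `W` satisfies `L W ≤ c W`, then
`e^{ct} W` is a supersolution, and a subsolution that is `o(W)` exceeds the minimal solution by
more than `ε e^{ct} W` at most on a finite set, where the excess has to vanish because the chain
stays put with positive probability. With `f = 1` the formula `GeneratorEq.dynkin` is
non-explosion, and in general it puts `f` into the extended domain (`inExtendedDomain`).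

For the birth and death process everything is a function `φ` of `|x|`, and `sizeDrift` computes
the generator at `φ(|x|)`. Suppressing the jumps to the origin means extending `φ` to `0` by `φ 1`,
which does not affect the drift when `|x| ≥ 2`.
Under the first condition the drift of `|x|` is eventually at most `-λ |x|` for every `λ`; as
`√|x| = o(|x|)`, the function `√|x|` is in the extended domain, and by concavity it satisfies
the Lyapunov condition as well. Under the second condition the drift of `exp(ε|x|)` is eventually
at most `-λ exp(ε|x|)` for all `λ` and all `0 < ε ≤ log δ`, so for `ε < log δ` one can take
`W = exp(log δ |x|)`.

Small sets and the comparison of survival probabilities only need irreducibility on `ℕ^d ∖ {0}`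
and the inequality `p_s(x,y) p_t(y,z) ≤ p_{s+t}(x,z)` (`trans_mul_trans_le`).
-/

/-! ### The backward equation -/

/-- Fubini's theorem on the triangle `0 ≤ s ≤ r ≤ t`, in the coordinates `s` and `r - s`. -/
theorem lintegral_triangle {F : ℝ → ℝ → ℝ≥0∞} (hF : Measurable (Function.uncurry F)) (t : ℝ) :
    ∫⁻ r in Icc (0 : ℝ) t, ∫⁻ s in Icc (0 : ℝ) r, F s (r - s) =
      ∫⁻ s in Icc (0 : ℝ) t, ∫⁻ r in Icc (0 : ℝ) (t - s), F s r := by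
  have e1 : ∀ r, (Icc (0 : ℝ) t).indicator
      (fun r => ∫⁻ s in Icc (0 : ℝ) r, F s (r - s)) r =
      ∫⁻ s, {p : ℝ × ℝ | 0 ≤ p.1 ∧ 0 ≤ p.2 ∧ p.1 + p.2 ≤ t}.indicator
        (Function.uncurry F) (s, r - s) := by
    intro r
    by_cases hr : r ∈ Icc (0 : ℝ) t
    · rw [indicator_of_mem hr, ← lintegral_indicator measurableSet_Icc]
      congr 1 with s
      simp only [indicator, mem_Icc, mem_ofPred_eq, Function.uncurry] at hr ⊢
      congr 1
      apply propext
      constructor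
      · rintro ⟨h1, h2⟩; exact ⟨h1, by linarith, by linarith [hr.2]⟩
      · rintro ⟨h1, h2, h3⟩; exact ⟨h1, by linarith⟩
    · rw [indicator_of_notMem hr, eq_comm, ← lintegral_zero (μ := (volume : Measure ℝ))]
      congr 1 with s
      apply indicator_of_notMem
      rintro ⟨h1, h2, h3⟩
      simp only at h1 h2 h3
      exact hr ⟨by linarith, by linarith⟩
  have e2 : ∀ s, (Icc (0 : ℝ) t).indicator
      (fun s => ∫⁻ r in Icc (0 : ℝ) (t - s), F s r) s =
      ∫⁻ r, {p : ℝ × ℝ | 0 ≤ p.1 ∧ 0 ≤ p.2 ∧ p.1 + p.2 ≤ t}.indicator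
        (Function.uncurry F) (s, r) := by
    intro s
    by_cases hs : s ∈ Icc (0 : ℝ) t
    · rw [indicator_of_mem hs, ← lintegral_indicator measurableSet_Icc]
      congr 1 with r
      simp only [indicator, mem_Icc, mem_ofPred_eq, Function.uncurry] at hs ⊢
      congr 1
      apply propext
      constructor
      · rintro ⟨h1, h2⟩; exact ⟨hs.1, h1, by linarith⟩
      · rintro ⟨h1, h2, h3⟩; exact ⟨h2, by linarith⟩
    · rw [indicator_of_notMem hs, eq_comm, ← lintegral_zero (μ := (volume : Measure ℝ))]
      congr 1 with r
      apply indicator_of_notMem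
      rintro ⟨h1, h2, h3⟩
      simp only at h1 h2 h3
      exact hs ⟨by linarith, by linarith⟩
  have hD : MeasurableSet {p : ℝ × ℝ | 0 ≤ p.1 ∧ 0 ≤ p.2 ∧ p.1 + p.2 ≤ t} := by
    refine MeasurableSet.inter (s₁ := {p : ℝ × ℝ | 0 ≤ p.1}) ?_
      (MeasurableSet.inter (s₁ := {p : ℝ × ℝ | 0 ≤ p.2})
        (s₂ := {p : ℝ × ℝ | p.1 + p.2 ≤ t}) ?_ ?_)
    · exact measurableSet_le measurable_const measurable_fst
    · exact measurableSet_le measurable_const measurable_snd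
    · exact measurableSet_le (measurable_fst.add measurable_snd) measurable_const
  have hG := hF.indicator hD
  rw [← lintegral_indicator measurableSet_Icc, ← lintegral_indicator measurableSet_Icc]
  simp_rw [e1, e2]
  rw [lintegral_lintegral_swap]
  · congr 1 with s
    exact lintegral_sub_right_eq_self (fun r =>
      {p : ℝ × ℝ | 0 ≤ p.1 ∧ 0 ≤ p.2 ∧ p.1 + p.2 ≤ t}.indicator (Function.uncurry F) (s, r)) s
  · exact (hG.comp (measurable_snd.prodMk (measurable_fst.sub measurable_snd))).aemeasurable

theorem measurable_lintegral_Icc {F : ℝ → ℝ → ℝ≥0∞} (hF : Measurable (Function.uncurry F)) :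
    Measurable fun t => ∫⁻ s in Icc (0 : ℝ) t, F t s := by
  have e : ∀ t, ∫⁻ s in Icc (0 : ℝ) t, F t s =
      ∫⁻ s, {p : ℝ × ℝ | 0 ≤ p.2 ∧ p.2 ≤ p.1}.indicator (Function.uncurry F) (t, s) := by
    intro t
    rw [← lintegral_indicator measurableSet_Icc]
    rfl
  simp_rw [e]
  refine Measurable.lintegral_prod_right' (hF.indicator ?_)
  exact MeasurableSet.inter (s₁ := {p : ℝ × ℝ | 0 ≤ p.2}) (s₂ := {p : ℝ × ℝ | p.2 ≤ p.1})
    (measurableSet_le measurable_const measurable_snd)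
    (measurableSet_le measurable_snd measurable_fst)

theorem ENNReal.tsum_iSup_of_monotone {S : Type*} {F : ℕ → S → ℝ≥0∞} (hF : Monotone F) :
    ∑' y, ⨆ n, F n y = ⨆ n, ∑' y, F n y := by
  let _ : MeasurableSpace S := ⊤
  simp_rw [← lintegral_count]
  exact lintegral_iSup (fun n => measurable_from_top) hF

namespace JumpRates

variable {S : Type} (q : JumpRates S)

/-- The probability that the chain started at `x` makes no jump during a time interval of
length `t`. -/
noncomputable def hold (x : S) (t : ℝ) : ℝ≥0∞ := ENNReal.ofReal (Real.exp (-(q.exitRate x : ℝ) * t))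

theorem measurable_hold (x : S) : Measurable (q.hold x) := by
  unfold hold; fun_prop

theorem hold_ne_top (x : S) (t : ℝ) : q.hold x t ≠ ∞ := ENNReal.ofReal_ne_top

theorem hold_pos (x : S) (t : ℝ) : 0 < q.hold x t := by
  unfold hold; positivity

theorem hold_add (x : S) (s t : ℝ) : q.hold x (s + t) = q.hold x s * q.hold x t := by
  unfold hold
  rw [← ENNReal.ofReal_mul (Real.exp_nonneg _), ← Real.exp_add, mul_add]

theorem coe_exitRate (x : S) : (q.exitRate x : ℝ≥0∞) = ∑' z, (q.rate x z : ℝ≥0∞) :=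
  ENNReal.coe_tsum (q.summable_rate x)

theorem hold_add_lintegral_real (a c t : ℝ) :
    Real.exp (-a * t) + ∫ s in (0 : ℝ)..t, Real.exp (-a * s) * ((a + c) * Real.exp (c * (t - s))) =
      Real.exp (c * t) := by
  have h : ∀ s ∈ uIcc 0 t, HasDerivAt (fun s => - (Real.exp (-a * s) * Real.exp (c * (t - s))))
      (Real.exp (-a * s) * ((a + c) * Real.exp (c * (t - s)))) s := by
    intro s _
    have h1 : HasDerivAt (fun s : ℝ => Real.exp (-a * s)) (Real.exp (-a * s) * (-a * 1)) s :=
      ((hasDerivAt_id s).const_mul (-a)).exp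
    have h2 : HasDerivAt (fun s : ℝ => Real.exp (c * (t - s)))
        (Real.exp (c * (t - s)) * (c * (-1))) s :=
      (((hasDerivAt_id s).const_sub t).const_mul c).exp
    refine (h1.mul h2).neg.congr_deriv ?_
    ring
  rw [intervalIntegral.integral_eq_sub_of_hasDerivAt h]
  · simp
  · apply Continuous.intervalIntegrable
    fun_prop

/-- Conditioning on the first jump, in the presence of exponential growth at rate `c`. -/
theorem hold_add_lintegral_exp (x : S) (c : ℝ≥0) {t : ℝ} (ht : 0 ≤ t) :
    q.hold x t + ∫⁻ s in Icc (0 : ℝ) t, q.hold x s *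
      ((q.exitRate x + c : ℝ≥0) * ENNReal.ofReal (Real.exp (c * (t - s)))) =
      ENNReal.ofReal (Real.exp (c * t)) := by
  rw [← hold_add_lintegral_real (q.exitRate x) c t, ENNReal.ofReal_add (Real.exp_nonneg _)
    (intervalIntegral.integral_nonneg ht fun s _ => by positivity)]
  congr 1
  rw [intervalIntegral.integral_of_le ht, ← integral_Icc_eq_integral_Ioc,
    ofReal_integral_eq_lintegral_ofReal]
  · refine lintegral_congr fun s => ?_
    rw [hold, ENNReal.ofReal_mul (Real.exp_nonneg _), ENNReal.ofReal_mul (by positivity),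
      ← ENNReal.ofReal_coe_nnreal]
    simp
  · apply Continuous.integrableOn_Icc
    fun_prop
  · exact Eventually.of_forall fun s => by positivity

/-- The first jump takes place either before or after time `t`. -/
theorem hold_add_lintegral (x : S) {t : ℝ} (ht : 0 ≤ t) :
    q.hold x t + ∫⁻ s in Icc (0 : ℝ) t, q.hold x s * q.exitRate x = 1 := by
  simpa using q.hold_add_lintegral_exp x 0 ht

/-- The right-hand side of the backward equation with terminal reward `f` and running reward `g`:
for a chain started at `x`, condition on the time of its first jump, if it occurs before `t`. -/
noncomputable def backward (f g : S → ℝ≥0∞) (u : ℝ → S → ℝ≥0∞) (t : ℝ) (x : S) : ℝ≥0∞ :=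
  q.hold x t * f x +
    ∫⁻ s in Icc (0 : ℝ) t, q.hold x s * (g x + ∑' z, (q.rate x z : ℝ≥0∞) * u (t - s) z)

theorem transAux_succ (n : ℕ) (t : ℝ) (x y : S) :
    q.transAux (n + 1) t x y = q.hold x t * (Set.indicator {y} 1 x) +
      ∫⁻ s in Icc (0 : ℝ) t, q.hold x s *
        ∑' z, (q.rate x z : ℝ≥0∞) * q.transAux n (t - s) z y := by
  classical
  simp only [transAux, hold, indicator, mem_singleton_iff]
  congr 1
  split_ifs <;> simp

variable {q}

theorem backward_mono {f g : S → ℝ≥0∞} {u v : ℝ → S → ℝ≥0∞} {t : ℝ} (x : S)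
    (h : ∀ s ∈ Icc 0 t, ∀ z, u s z ≤ v s z) :
    q.backward f g u t x ≤ q.backward f g v t x := by
  unfold backward
  refine add_le_add le_rfl ?_
  refine setLIntegral_mono' measurableSet_Icc fun s hs => ?_
  gcongr (_ * (_ + ?_))
  refine ENNReal.tsum_le_tsum fun z => ?_
  gcongr
  exact h _ ⟨by linarith [hs.2], by linarith [hs.1]⟩ z

variable (q)

theorem transAux_mono_succ (n : ℕ) (t : ℝ) (x y : S) :
    q.transAux n t x y ≤ q.transAux (n + 1) t x y := by
  induction n generalizing t x with
  | zero => simp [transAux]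
  | succ n ih =>
    rw [q.transAux_succ n, q.transAux_succ (n + 1)]
    gcongr with s z
    exact ih _ _

theorem monotone_transAux (t : ℝ) (x y : S) : Monotone fun n => q.transAux n t x y :=
  monotone_nat_of_le_succ fun n => q.transAux_mono_succ n t x y

theorem transAux_le_trans (n : ℕ) (t : ℝ) (x y : S) : q.transAux n t x y ≤ q.trans t x y :=
  le_iSup (fun n => q.transAux n t x y) n

/-- The expectation of `f` at time `t`, for the chain started at `x`, on the event that there are
at most `n - 1` jumps before `t`. -/
noncomputable def meanAux (n : ℕ) (f : S → ℝ≥0∞) (t : ℝ) (x : S) : ℝ≥0∞ :=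
  ∑' y, q.transAux n t x y * f y

theorem monotone_meanAux (f : S → ℝ≥0∞) (t : ℝ) (x : S) : Monotone fun n => q.meanAux n f t x := by
  intro m n h
  unfold meanAux
  dsimp only
  gcongr with y
  exact q.monotone_transAux t x y h

/-- The expected total reward up to time `t`, with running reward `g` and terminal reward `f`,
counting only the trajectories with at most `n - 1` jumps. -/
noncomputable def rewardAux (n : ℕ) (f g : S → ℝ≥0∞) (t : ℝ) (x : S) : ℝ≥0∞ :=
  q.meanAux n f t x + ∫⁻ s in Icc (0 : ℝ) t, q.meanAux n g s x

theorem monotone_rewardAux (f g : S → ℝ≥0∞) (t : ℝ) (x : S) :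
    Monotone fun n => q.rewardAux n f g t x := by
  intro m n h
  unfold rewardAux
  exact add_le_add (q.monotone_meanAux f t x h)
    (lintegral_mono fun s => q.monotone_meanAux g s x h)

/-- The expectation of `f` at time `t` for the chain started at `x`. -/
noncomputable def mean (f : S → ℝ≥0∞) (t : ℝ) (x : S) : ℝ≥0∞ := ∑' y, q.trans t x y * f y

theorem mean_eq_iSup (f : S → ℝ≥0∞) (t : ℝ) (x : S) : q.mean f t x = ⨆ n, q.meanAux n f t x := by
  unfold mean meanAux trans
  simp_rw [ENNReal.iSup_mul]
  exact ENNReal.tsum_iSup_of_monotone fun m n h y => by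
    dsimp only
    gcongr
    exact q.monotone_transAux t x y h

/-- The expected total reward up to time `t`, with running reward `g` and terminal reward `f`. -/
noncomputable def reward (f g : S → ℝ≥0∞) (t : ℝ) (x : S) : ℝ≥0∞ :=
  q.mean f t x + ∫⁻ s in Icc (0 : ℝ) t, q.mean g s x

variable [Countable S]

theorem measurable_transAux (n : ℕ) (x y : S) : Measurable fun t => q.transAux n t x y := by
  induction n generalizing x with
  | zero => exact measurable_const
  | succ n ih =>
    simp_rw [transAux_succ]
    refine ((q.measurable_hold x).mul measurable_const).add (measurable_lintegral_Icc ?_)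
    refine ((q.measurable_hold x).comp measurable_snd).mul (Measurable.tsum fun z => ?_)
    exact measurable_const.mul ((ih z).comp (measurable_fst.sub measurable_snd))

theorem measurable_trans (x y : S) : Measurable fun t => q.trans t x y :=
  Measurable.iSup fun n => q.measurable_transAux n x y

theorem measurable_meanAux (n : ℕ) (f : S → ℝ≥0∞) (x : S) : Measurable fun t => q.meanAux n f t x :=
  Measurable.tsum fun y => (q.measurable_transAux n x y).mul_const _

theorem meanAux_succ (n : ℕ) (f : S → ℝ≥0∞) (t : ℝ) (x : S) :
    q.meanAux (n + 1) f t x = q.backward f 0 (q.meanAux n f) t x := by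
  unfold backward meanAux
  simp_rw [transAux_succ, add_mul]
  rw [ENNReal.tsum_add]
  congr 1
  · rw [tsum_eq_single x]
    · simp
    · intro y hy
      simp [hy.symm]
  · have hm : ∀ y, Measurable fun s => q.hold x s *
        ∑' z, (q.rate x z : ℝ≥0∞) * q.transAux n (t - s) z y := fun y =>
      (q.measurable_hold x).mul (Measurable.tsum fun z =>
        measurable_const.mul ((q.measurable_transAux n z y).comp
          (measurable_const.sub measurable_id)))
    simp_rw [← lintegral_mul_const _ (hm _)]
    rw [← lintegral_tsum fun y => ((hm y).mul_const _).aemeasurable]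
    refine lintegral_congr fun s => ?_
    simp_rw [mul_assoc]
    rw [ENNReal.tsum_mul_left]
    congr 1
    simp only [Pi.zero_apply, zero_add, ← ENNReal.tsum_mul_left, ← ENNReal.tsum_mul_right]
    rw [ENNReal.tsum_comm]
    simp_rw [mul_assoc]

theorem measurable_rewardAux (n : ℕ) (f g : S → ℝ≥0∞) (x : S) :
    Measurable fun t => q.rewardAux n f g t x :=
  (q.measurable_meanAux n f x).add
    (measurable_lintegral_Icc ((q.measurable_meanAux n g x).comp measurable_snd))

theorem rewardAux_succ (n : ℕ) (f g : S → ℝ≥0∞) (t : ℝ) (x : S) :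
    q.rewardAux (n + 1) f g t x = q.backward f g (q.rewardAux n f g) t x := by
  have hm : ∀ z, Measurable (fun s => q.meanAux n g s z) := fun z => q.measurable_meanAux n g z
  have hm' : ∀ z, Measurable (fun s => q.meanAux n f s z) := fun z => q.measurable_meanAux n f z
  have hh := q.measurable_hold x
  have key : ∫⁻ r in Icc (0 : ℝ) t, q.meanAux (n + 1) g r x =
      ∫⁻ s in Icc (0 : ℝ) t, q.hold x s *
        (g x + ∑' z, (q.rate x z : ℝ≥0∞) * ∫⁻ r in Icc (0 : ℝ) (t - s), q.meanAux n g r z) := by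
    simp_rw [meanAux_succ, backward, Pi.zero_apply, zero_add]
    have hF : Measurable (Function.uncurry fun s r => q.hold x s *
        ∑' z, (q.rate x z : ℝ≥0∞) * q.meanAux n g r z) :=
      (hh.comp measurable_fst).mul (Measurable.tsum fun z =>
        measurable_const.mul ((hm z).comp measurable_snd))
    rw [lintegral_add_left (hh.mul_const _), lintegral_triangle hF, ← lintegral_add_left
      (hh.mul_const _)]
    refine lintegral_congr fun s => ?_
    rw [mul_add, lintegral_const_mul _ (Measurable.tsum fun z => (hm z).const_mul _),
      lintegral_tsum fun z => ((hm z).const_mul _).aemeasurable]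
    simp_rw [lintegral_const_mul _ (hm _)]
  rw [rewardAux, key, meanAux_succ]
  simp only [backward, Pi.zero_apply, zero_add]
  rw [add_assoc, ← lintegral_add_left]
  · congr 1
    refine lintegral_congr fun s => ?_
    simp only [rewardAux, mul_add, ENNReal.tsum_add]
    ring
  · exact hh.mul (Measurable.tsum fun z =>
      measurable_const.mul ((hm' z).comp (measurable_const.sub measurable_id)))

theorem measurable_mean (f : S → ℝ≥0∞) (x : S) : Measurable fun t => q.mean f t x :=
  Measurable.tsum fun y => (q.measurable_trans x y).mul_const _

theorem reward_eq_iSup (f g : S → ℝ≥0∞) (t : ℝ) (x : S) :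
    q.reward f g t x = ⨆ n, q.rewardAux n f g t x := by
  unfold reward rewardAux
  simp_rw [mean_eq_iSup]
  rw [lintegral_iSup (fun n => q.measurable_meanAux n g x)
    (fun m n h s => q.monotone_meanAux g s x h), ENNReal.iSup_add_iSup_of_monotone]
  · exact q.monotone_meanAux f t x
  · exact fun m n h => lintegral_mono fun s => q.monotone_meanAux g s x h

/-- The expected reward solves the backward equation. -/
theorem backward_reward (f g : S → ℝ≥0∞) (t : ℝ) (x : S) :
    q.backward f g (q.reward f g) t x = q.reward f g t x := by
  have hmon : ∀ r z, Monotone fun n => q.rewardAux n f g r z := q.monotone_rewardAux f g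
  have h1 : q.backward f g (q.reward f g) t x = ⨆ n, q.backward f g (q.rewardAux n f g) t x := by
    unfold backward
    simp_rw [reward_eq_iSup, ENNReal.mul_iSup]
    rw [← ENNReal.add_iSup, ← lintegral_iSup]
    · congr 1
      refine lintegral_congr fun s => ?_
      rw [ENNReal.tsum_iSup_of_monotone, ENNReal.add_iSup, ENNReal.mul_iSup]
      intro m n h z
      dsimp only
      gcongr
      exact hmon _ _ h
    · intro n
      exact (q.measurable_hold x).mul (measurable_const.add (Measurable.tsum fun z =>
        measurable_const.mul ((q.measurable_rewardAux n f g z).comp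
          (measurable_const.sub measurable_id))))
    · intro m n h s
      dsimp only
      gcongr with z
      exact hmon _ _ h
  rw [h1, reward_eq_iSup]
  simp_rw [← rewardAux_succ]
  exact (hmon t x).iSup_nat_add 1

variable {q}

/-- The expected reward is the smallest supersolution of the backward equation. -/
theorem reward_le {f g : S → ℝ≥0∞} {u : ℝ → S → ℝ≥0∞}
    (hu : ∀ t, 0 ≤ t → ∀ x, q.backward f g u t x ≤ u t x) {t : ℝ} (ht : 0 ≤ t) (x : S) :
    q.reward f g t x ≤ u t x := by
  rw [reward_eq_iSup]
  refine iSup_le fun n => ?_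
  induction n generalizing t x with
  | zero => simp [rewardAux, meanAux, transAux]
  | succ n ih =>
    rw [rewardAux_succ]
    exact (backward_mono x fun s hs z => ih hs.1 z).trans (hu t ht x)

end JumpRates

/-! ### The comparison principle and Dynkin's formula -/

namespace JumpRates

variable {S : Type} {q : JumpRates S}

/-- `f = o(W)` along the filter of cofinite sets: for every `ε > 0`, `f ≤ ε W` off a finite set. -/
def Dominated (f W : S → ℝ≥0∞) : Prop := ∀ ε : ℝ≥0, 0 < ε → {x | ε * W x < f x}.Finite

variable (q) in
/-- `W` is finite and its drift is at most `c W`; written without subtraction, with the total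
jump rate moved to the right-hand side. -/
structure GrowthBound (c : ℝ≥0) (W : S → ℝ≥0∞) : Prop where
  ne_top : ∀ x, W x ≠ ∞
  drift : ∀ x, ∑' z, (q.rate x z : ℝ≥0∞) * W z ≤ (q.exitRate x + c : ℝ≥0) * W x

/-- Under a growth bound, `e^{ct} W(x)` is a supersolution of the backward equation. -/
theorem GrowthBound.lintegral_le {c : ℝ≥0} {W : S → ℝ≥0∞} (hW : q.GrowthBound c W) {t : ℝ}
    (ht : 0 ≤ t) (x : S) :
    ∫⁻ s in Icc (0 : ℝ) t, q.hold x s * ∑' z, (q.rate x z : ℝ≥0∞) *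
      (ENNReal.ofReal (Real.exp (c * (t - s))) * W z) ≤
    ENNReal.ofReal (Real.exp (c * t)) * W x := by
  rw [← q.hold_add_lintegral_exp x c ht, add_mul]
  refine le_add_left ?_
  have hm : Measurable fun s => q.hold x s *
      ((q.exitRate x + c : ℝ≥0) * ENNReal.ofReal (Real.exp (c * (t - s)))) := by
    have := q.measurable_hold x
    fun_prop
  rw [← lintegral_mul_const _ hm]
  refine lintegral_mono fun s => ?_
  calc q.hold x s * ∑' z, (q.rate x z : ℝ≥0∞) * (ENNReal.ofReal (Real.exp (c * (t - s))) * W z)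
      = q.hold x s * (ENNReal.ofReal (Real.exp (c * (t - s))) *
        ∑' z, (q.rate x z : ℝ≥0∞) * W z) := by
        simp only [← ENNReal.tsum_mul_left]
        refine tsum_congr fun z => ?_
        ring
    _ ≤ q.hold x s * (ENNReal.ofReal (Real.exp (c * (t - s))) *
        ((q.exitRate x + c : ℝ≥0) * W x)) := by
        gcongr
        exact hW.drift x
    _ = _ := by ring

theorem backward_add_le {f g : S → ℝ≥0∞} {A G : ℝ → S → ℝ≥0∞} {M : ℝ≥0∞} {t T : ℝ}
    (htT : t ≤ T) (x : S)
    (hG : Measurable fun s => ∑' z, (q.rate x z : ℝ≥0∞) * G (t - s) z) :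
    q.backward f g (fun s z => A s z + (G s z + M)) t x ≤
      q.backward f g A t x + ((∫⁻ s in Icc (0 : ℝ) t, q.hold x s *
        ∑' z, (q.rate x z : ℝ≥0∞) * G (t - s) z) +
        (∫⁻ s in Icc (0 : ℝ) T, q.hold x s * q.exitRate x) * M) := by
  have hh := q.measurable_hold x
  calc q.backward f g (fun s z => A s z + (G s z + M)) t x
      = q.backward f g A t x + ((∫⁻ s in Icc (0 : ℝ) t, q.hold x s *
        ∑' z, (q.rate x z : ℝ≥0∞) * G (t - s) z) +
        (∫⁻ s in Icc (0 : ℝ) t, q.hold x s * q.exitRate x) * M) := by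
        unfold backward
        rw [add_assoc, ← lintegral_mul_const _ (hh.mul_const _),
          ← lintegral_add_right _ ((hh.mul_const _).mul_const _), ← lintegral_add_right]
        · congr 1
          refine lintegral_congr fun s => ?_
          simp only [mul_add, ENNReal.tsum_add, ENNReal.tsum_mul_right, ← coe_exitRate]
          ring
        · exact (hh.mul hG).add ((hh.mul_const _).mul_const _)
    _ ≤ _ := by gcongr

/-- Comparison principle: a subsolution of the backward equation that is negligible with respect
to a function `W` with a growth bound lies below every supersolution. The difference minus
`ε e^{ct} W` can only be positive on a finite set, where its supremum `M` satisfies `M ≤ r M` for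
some `r < 1`, as the chain makes no jump before `T` with positive probability. -/
theorem comparison {f g h W : S → ℝ≥0∞} {A B : ℝ → S → ℝ≥0∞} {c : ℝ≥0} {T : ℝ}
    (hW : q.GrowthBound c W)
    (hA : ∀ t ∈ Icc 0 T, ∀ x, q.backward f g A t x ≤ A t x)
    (hB : ∀ t ∈ Icc 0 T, ∀ x, B t x ≤ q.backward f g B t x)
    (hBh : ∀ t ∈ Icc 0 T, ∀ x, B t x ≤ h x) (hh : ∀ x, h x ≠ ∞) (hhW : Dominated h W)
    {t : ℝ} (ht : t ∈ Icc 0 T) (x : S) : B t x ≤ A t x := by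
  have main : ∀ ε : ℝ≥0, 0 < ε → ∀ t ∈ Icc 0 T, ∀ x,
      B t x ≤ A t x + ε * (ENNReal.ofReal (Real.exp (c * t)) * W x) := by
    intro ε hε
    set G : ℝ → S → ℝ≥0∞ := fun t x => ε * (ENNReal.ofReal (Real.exp (c * t)) * W x) with hGdef
    -- `m x` is the largest excess of `B` over `A + G` at `x`; it vanishes off a finite set.
    set m : S → ℝ≥0∞ := fun x => ⨆ t ∈ Icc 0 T, B t x - (A t x + G t x) with hm
    have hBm : ∀ t ∈ Icc 0 T, ∀ x, B t x ≤ A t x + (G t x + m x) := by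
      intro t ht x
      rw [← add_assoc, add_comm, ← tsub_le_iff_right]
      exact le_iSup₂ (f := fun t _ => B t x - (A t x + G t x)) t ht
    have hm0 : ∀ x, x ∉ {x | ε * W x < h x} → m x = 0 := by
      intro x hx
      simp only [hm, tsub_eq_zero_iff_le, ENNReal.iSup_eq_zero]
      intro t ht
      refine (hBh t ht x).trans ((not_lt.1 hx).trans (le_add_left ?_))
      simp only [hGdef]
      gcongr
      refine le_mul_of_one_le_left' ?_
      rw [ENNReal.one_le_ofReal, Real.one_le_exp_iff]
      exact mul_nonneg c.2 ht.1
    have hmt : ∀ x, m x ≠ ∞ := fun x =>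
      ne_top_of_le_ne_top (hh x) (iSup₂_le fun t ht => tsub_le_self.trans (hBh t ht x))
    have hmx : ∀ x, m x = 0 := by
      by_contra! hne
      obtain ⟨y, hy⟩ := hne
      have hfin := hhW ε hε
      have hyF : y ∈ hfin.toFinset := by
        rw [Finite.mem_toFinset]
        by_contra h
        exact hy (hm0 y h)
      -- Apply the backward equation once at a point where the excess is maximal.
      obtain ⟨x, -, hmax⟩ := Finset.exists_max_image hfin.toFinset m ⟨y, hyF⟩
      have hle : ∀ z, m z ≤ m x := by
        intro z
        by_cases hz : z ∈ {x | ε * W x < h x}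
        · exact hmax z (hfin.mem_toFinset.2 hz)
        · simp [hm0 z hz]
      have hstep : ∀ t ∈ Icc 0 T, B t x ≤
          A t x + (G t x + (∫⁻ s in Icc (0 : ℝ) T, q.hold x s * q.exitRate x) * m x) := by
        intro t ht
        have hGsum : ∀ s, ∑' z, (q.rate x z : ℝ≥0∞) * G (t - s) z = ε * ∑' z,
            (q.rate x z : ℝ≥0∞) * (ENNReal.ofReal (Real.exp (c * (t - s))) * W z) := by
          intro s
          rw [← ENNReal.tsum_mul_left]
          congr 1 with z
          simp only [hGdef]
          ring
        have hmeas : Measurable fun s => ∑' z, (q.rate x z : ℝ≥0∞) *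
            (ENNReal.ofReal (Real.exp (c * (t - s))) * W z) := by
          have : ∀ s, ∑' z, (q.rate x z : ℝ≥0∞) *
              (ENNReal.ofReal (Real.exp (c * (t - s))) * W z) =
              ENNReal.ofReal (Real.exp (c * (t - s))) * ∑' z, (q.rate x z : ℝ≥0∞) * W z := by
            intro s
            rw [← ENNReal.tsum_mul_left]
            congr 1 with z
            ring
          simp_rw [this]
          fun_prop
        refine (hB t ht x).trans ((backward_mono (v := fun s z => A s z + (G s z + m x)) x
          fun s hs z => ?_).trans ((backward_add_le ht.2 x ?_).trans ?_))
        · refine (hBm s ⟨hs.1, hs.2.trans ht.2⟩ z).trans ?_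
          gcongr
          exact hle z
        · simp_rw [hGsum]
          exact hmeas.const_mul _
        · gcongr
          · exact hA t ht x
          · simp_rw [hGsum, mul_left_comm _ (ε : ℝ≥0∞)]
            rw [lintegral_const_mul _ (by
              exact (q.measurable_hold x).mul hmeas)]
            simp only [hGdef]
            gcongr
            exact hW.lintegral_le ht.1 x
      have hrec : m x ≤ (∫⁻ s in Icc (0 : ℝ) T, q.hold x s * q.exitRate x) * m x := by
        refine iSup₂_le fun t ht => ?_
        rw [tsub_le_iff_right, add_comm, add_assoc]
        exact hstep t ht
      have h1 : q.hold x T * m x + m x ≤ 0 + m x := by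
        calc q.hold x T * m x + m x ≤ q.hold x T * m x +
              (∫⁻ s in Icc (0 : ℝ) T, q.hold x s * q.exitRate x) * m x := by gcongr
          _ = 0 + m x := by
              rw [← add_mul, q.hold_add_lintegral x (ht.1.trans ht.2), one_mul, zero_add]
      have h2 := (ENNReal.add_le_add_iff_right (hmt x)).1 h1
      have h3 : m x = 0 := by
        rcases mul_eq_zero.1 (le_zero_iff.1 h2) with h | h
        · exact absurd h (q.hold_pos x T).ne'
        · exact h
      exact hy (le_zero_iff.1 (h3 ▸ hle y))
    intro t ht x
    simpa [hmx x] using hBm t ht x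
  have hk : ENNReal.ofReal (Real.exp (c * t)) * W x ≠ ∞ :=
    ENNReal.mul_ne_top ENNReal.ofReal_ne_top (hW.ne_top x)
  have hlim : Tendsto (fun ε : ℝ≥0 => A t x + ε * (ENNReal.ofReal (Real.exp (c * t)) * W x))
      (𝓝[>] 0) (𝓝 (A t x + (0 : ℝ≥0) * (ENNReal.ofReal (Real.exp (c * t)) * W x))) := by
    refine Tendsto.mono_left ?_ nhdsWithin_le_nhds
    refine tendsto_const_nhds.add (ENNReal.Tendsto.mul_const ?_ (Or.inr hk))
    exact ENNReal.tendsto_coe.2 tendsto_id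
  simp only [ENNReal.coe_zero, zero_mul, add_zero] at hlim
  exact ge_of_tendsto hlim (eventually_nhdsWithin_of_forall fun ε hε => main ε hε t ht x)

theorem mean_eq_reward (f : S → ℝ≥0∞) (t : ℝ) (x : S) : q.mean f t x = q.reward f 0 t x := by
  simp [reward, mean]

variable [Countable S]

theorem mean_one_le {t : ℝ} (ht : 0 ≤ t) (x : S) : q.mean 1 t x ≤ 1 := by
  rw [mean_eq_reward]
  refine reward_le (u := fun _ _ => 1) (fun t ht x => ?_) ht x
  simpa [backward, coe_exitRate] using (q.hold_add_lintegral x ht).le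

theorem mean_le_of_le {f : S → ℝ≥0∞} {C : ℝ≥0∞} (hf : ∀ x, f x ≤ C) {t : ℝ} (ht : 0 ≤ t)
    (x : S) : q.mean f t x ≤ C := by
  calc q.mean f t x ≤ ∑' y, C * (q.trans t x y * (1 : S → ℝ≥0∞) y) :=
        ENNReal.tsum_le_tsum fun y => by
          rw [Pi.one_apply, mul_one, mul_comm]
          gcongr
          exact hf y
    _ = C * q.mean 1 t x := ENNReal.tsum_mul_left
    _ ≤ C := mul_le_of_le_one_right' (mean_one_le ht x)

variable (q) in
/-- `u` is the value at `f` of the generator: `∑ z, q(x,z) (f z - f x) = u⁺ x - u⁻ x`, written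
without subtraction. -/
def GeneratorEq (f gp gm : S → ℝ≥0∞) : Prop :=
  ∀ x, ∑' z, (q.rate x z : ℝ≥0∞) * f z + gm x = q.exitRate x * f x + gp x

theorem GeneratorEq.backward_eq {f gp gm : S → ℝ≥0∞} (hf : q.GeneratorEq f gp gm) {t : ℝ}
    (ht : 0 ≤ t) (x : S) :
    q.backward f gm (fun t x => f x + q.reward 0 gp t x) t x = f x + q.reward 0 gp t x := by
  have hh := q.measurable_hold x
  conv_rhs => rw [← q.backward_reward 0 gp t x]
  rw [← one_mul (f x), ← q.hold_add_lintegral x ht, add_mul,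
    ← lintegral_mul_const _ (hh.mul_const _)]
  simp only [backward, Pi.zero_apply, mul_zero, zero_add]
  rw [add_assoc, ← lintegral_add_left ((hh.mul_const _).mul_const _)]
  · congr 1
    refine lintegral_congr fun s => ?_
    rw [mul_assoc, ← mul_add, ← add_assoc, ← hf x]
    simp only [mul_add, ENNReal.tsum_add]
    ring

/-- Dynkin's formula, with the negative part of the generator on the left-hand side. -/
theorem GeneratorEq.dynkin {f gp gm W : S → ℝ≥0∞} {c C : ℝ≥0} (hf : q.GeneratorEq f gp gm)
    (hgp : ∀ x, gp x ≤ C) (hW : q.GrowthBound c W) (h1 : ∀ x, 1 ≤ f x) (hft : ∀ x, f x ≠ ∞)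
    (hfW : Dominated f W) {t : ℝ} (ht : 0 ≤ t) (x : S) :
    q.mean f t x + ∫⁻ s in Icc (0 : ℝ) t, q.mean gm s x =
      f x + ∫⁻ s in Icc (0 : ℝ) t, q.mean gp s x := by
  have e : ∀ t x, q.reward 0 gp t x = ∫⁻ s in Icc (0 : ℝ) t, q.mean gp s x := fun t x => by
    simp [reward, mean]
  rw [← e]
  apply le_antisymm
  · exact reward_le (u := fun t x => f x + q.reward 0 gp t x)
      (fun t ht x => (hf.backward_eq ht x).le) ht x
  -- As `f ≥ 1`, the right-hand side is at most `(1 + C t) f` up to time `t`, hence `o(W)`.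
  · set K : ℝ≥0 := 1 + C * t.toNNReal with hK
    have hK0 : 0 < K := by positivity
    refine comparison (h := fun x => K * f x) (A := q.reward f gm)
      (B := fun t x => f x + q.reward 0 gp t x) (T := t) hW
      (fun t _ x => (q.backward_reward f gm t x).le) (fun t ht x => (hf.backward_eq ht.1 x).ge)
      (fun s hs x => ?_) (fun x => ENNReal.mul_ne_top ENNReal.coe_ne_top (hft x)) ?_
      ⟨ht, le_rfl⟩ x
    · rw [e, hK, ENNReal.coe_add, add_mul, ENNReal.coe_one, one_mul]
      gcongr
      calc ∫⁻ r in Icc (0 : ℝ) s, q.mean gp r x ≤ ∫⁻ r in Icc (0 : ℝ) s, C :=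
            setLIntegral_mono' measurableSet_Icc fun r hr => mean_le_of_le hgp hr.1 x
        _ = C * ENNReal.ofReal s := by simp
        _ ≤ (C * t.toNNReal : ℝ≥0) * 1 := by
            rw [mul_one, ENNReal.coe_mul]
            gcongr
            exact ENNReal.ofReal_le_ofReal hs.2
        _ ≤ _ := by gcongr; exact h1 x
    · intro ε hε
      refine (hfW (ε / K) (by positivity)).subset fun y hy => ?_
      simp only [mem_ofPred_eq] at hy ⊢
      rw [ENNReal.coe_div hK0.ne', ENNReal.mul_comm_div, ← mul_div_assoc,
        ENNReal.div_lt_iff (by simp [hK0.ne']) (by simp), mul_comm (f y)]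
      exact hy

variable [MeasurableSpace S] [DiscreteMeasurableSpace S]

theorem lintegral_law (f : S → ℝ≥0∞) (t : ℝ) (x : S) :
    ∫⁻ y, f y ∂(q.law t x) = q.mean f t x := by
  rw [law, lintegral_sum_measure]
  simp [mean, lintegral_smul_measure, lintegral_dirac]

theorem GrowthBound.nonExplosive {W : S → ℝ≥0∞} {c : ℝ≥0} (hW : q.GrowthBound c W)
    (h : Dominated 1 W) : q.NonExplosive := by
  intro t ht x
  constructor
  rw [← lintegral_one]
  change ∫⁻ y, (1 : S → ℝ≥0∞) y ∂(q.law t x) = 1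
  rw [lintegral_law]
  have := GeneratorEq.dynkin (q := q) (f := 1) (gp := 0) (gm := 0) (C := 0)
    (fun x => by simp [coe_exitRate]) (by simp) hW (by simp) (by simp) h ht x
  simpa [mean] using this

/-- A function `f ≥ 1` with drift bounded above and negligible with respect to a function with a
growth bound is in the extended domain of the generator. -/
theorem inExtendedDomain {f U : S → ℝ} {W : S → ℝ≥0∞} {c : ℝ≥0} {C : ℝ}
    (hf : q.GeneratorEq (fun x => ENNReal.ofReal (f x)) (fun x => ENNReal.ofReal (U x))
      (fun x => ENNReal.ofReal (-U x)))
    (hU : ∀ x, U x ≤ C) (hW : q.GrowthBound c W) (h1 : ∀ x, 1 ≤ f x)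
    (hfW : Dominated (fun x => ENNReal.ofReal (f x)) W) :
    InExtendedDomain q.law f U := by
  have hdyn : ∀ x, ∀ t : ℝ, 0 ≤ t →
      q.mean (fun x => ENNReal.ofReal (f x)) t x +
        ∫⁻ s in Icc (0 : ℝ) t, q.mean (fun x => ENNReal.ofReal (-U x)) s x =
      ENNReal.ofReal (f x) + ∫⁻ s in Icc (0 : ℝ) t, q.mean (fun x => ENNReal.ofReal (U x)) s x :=
    fun x t ht => hf.dynkin (C := C.toNNReal) (fun x => ENNReal.ofReal_le_ofReal (hU x)) hW
      (fun x => by simpa using h1 x) (fun x => ENNReal.ofReal_ne_top) hfW ht x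
  have hp : ∀ x, ∀ s : ℝ, 0 ≤ s → q.mean (fun x => ENNReal.ofReal (U x)) s x ≤ ENNReal.ofReal C :=
    fun x s hs => mean_le_of_le (fun x => ENNReal.ofReal_le_ofReal (hU x)) hs x
  have hpt : ∀ x, ∀ t : ℝ,
      ∫⁻ s in Icc (0 : ℝ) t, q.mean (fun x => ENNReal.ofReal (U x)) s x ≠ ∞ := by
    intro x t
    refine ne_top_of_le_ne_top ?_ (setLIntegral_mono' measurableSet_Icc fun s hs => hp x s hs.1)
    simp [ENNReal.mul_eq_top]
  have hsum : ∀ x, ∀ t : ℝ, 0 ≤ t →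
      q.mean (fun x => ENNReal.ofReal (f x)) t x +
        ∫⁻ s in Icc (0 : ℝ) t, q.mean (fun x => ENNReal.ofReal (-U x)) s x ≠ ∞ := by
    intro x t ht
    rw [hdyn x t ht]
    exact ENNReal.add_ne_top.2 ⟨ENNReal.ofReal_ne_top, hpt x t⟩
  have hft : ∀ x, ∀ t : ℝ, 0 ≤ t → q.mean (fun x => ENNReal.ofReal (f x)) t x ≠ ∞ :=
    fun x t ht => (ENNReal.add_ne_top.1 (hsum x t ht)).1
  have hmt : ∀ x, ∀ t : ℝ, 0 ≤ t →
      ∫⁻ s in Icc (0 : ℝ) t, q.mean (fun x => ENNReal.ofReal (-U x)) s x ≠ ∞ :=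
    fun x t ht => (ENNReal.add_ne_top.1 (hsum x t ht)).2
  have hf0 : ∀ x, 0 ≤ f x := fun x => zero_le_one.trans (h1 x)
  have hint : ∀ x t, q.mean (fun x => ENNReal.ofReal (U x)) t x ≠ ∞ →
      q.mean (fun x => ENNReal.ofReal (-U x)) t x ≠ ∞ → Integrable U (q.law t x) := by
    intro x t ha hb
    refine ⟨(Measurable.of_discrete (f := U)).aestronglyMeasurable, ?_⟩
    rw [hasFiniteIntegral_iff_norm]
    have : ∀ y, ENNReal.ofReal ‖U y‖ = ENNReal.ofReal (U y) + ENNReal.ofReal (-U y) := by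
      intro y
      rcases le_total 0 (U y) with h | h
      · simp [abs_of_nonneg h, ENNReal.ofReal_of_nonpos (neg_nonpos.2 h)]
      · simp [abs_of_nonpos h, ENNReal.ofReal_of_nonpos h]
    simp_rw [this]
    rw [lintegral_add_left Measurable.of_discrete, lintegral_law, lintegral_law]
    exact (ENNReal.add_ne_top.2 ⟨ha, hb⟩).lt_top
  refine ⟨Measurable.of_discrete, Measurable.of_discrete, fun x t ht => ?_, fun x t ht => ?_,
    fun x t ht => ?_⟩
  · refine ⟨(Measurable.of_discrete (f := f)).aestronglyMeasurable, ?_⟩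
    rw [hasFiniteIntegral_iff_ofReal (Eventually.of_forall hf0), lintegral_law]
    exact (hft x t ht).lt_top
  · have : ∀ s, ∫⁻ y, ENNReal.ofReal |U y| ∂(q.law s x) =
        q.mean (fun x => ENNReal.ofReal (U x)) s x +
          q.mean (fun x => ENNReal.ofReal (-U x)) s x := by
      intro s
      rw [← lintegral_law, ← lintegral_law, ← lintegral_add_left Measurable.of_discrete]
      refine lintegral_congr fun y => ?_
      rcases le_total 0 (U y) with h | h
      · simp [abs_of_nonneg h, ENNReal.ofReal_of_nonpos (neg_nonpos.2 h)]
      · simp [abs_of_nonpos h, ENNReal.ofReal_of_nonpos h]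
    simp_rw [this]
    rw [lintegral_add_left (q.measurable_mean _ x)]
    exact (ENNReal.add_ne_top.2 ⟨hpt x t, hmt x t ht⟩).lt_top
  · have hmp := (q.measurable_mean (fun x => ENNReal.ofReal (U x)) x)
    have hmm := (q.measurable_mean (fun x => ENNReal.ofReal (-U x)) x)
    have hpae : ∀ᵐ s ∂(volume.restrict (Icc (0 : ℝ) t)),
        q.mean (fun x => ENNReal.ofReal (U x)) s x < ∞ :=
      ae_lt_top hmp (hpt x t)
    have hmae : ∀ᵐ s ∂(volume.restrict (Icc (0 : ℝ) t)),
        q.mean (fun x => ENNReal.ofReal (-U x)) s x < ∞ :=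
      ae_lt_top hmm (hmt x t ht)
    rw [intervalIntegral.integral_of_le ht, ← integral_Icc_eq_integral_Ioc]
    -- `U` is integrable at almost every time, so the default value of the integral is harmless.
    have e1 : ∫ s in Icc (0 : ℝ) t, ∫ y, U y ∂(q.law s x) =
        ∫ s in Icc (0 : ℝ) t, ((q.mean (fun x => ENNReal.ofReal (U x)) s x).toReal -
          (q.mean (fun x => ENNReal.ofReal (-U x)) s x).toReal) := by
      refine integral_congr_ae ?_
      filter_upwards [hpae, hmae] with s h1 h2
      rw [integral_eq_lintegral_pos_part_sub_lintegral_neg_part (hint x s h1.ne h2.ne),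
        lintegral_law, lintegral_law]
    rw [e1, integral_sub (integrable_toReal_of_lintegral_ne_top hmp.aemeasurable (hpt x t))
      (integrable_toReal_of_lintegral_ne_top hmm.aemeasurable (hmt x t ht)),
      integral_toReal hmp.aemeasurable hpae, integral_toReal hmm.aemeasurable hmae,
      integral_eq_lintegral_of_nonneg_ae (Eventually.of_forall hf0)
        (Measurable.of_discrete (f := f)).aestronglyMeasurable, lintegral_law]
    have := congrArg ENNReal.toReal (hdyn x t ht)
    rw [ENNReal.toReal_add (hft x t ht) (hmt x t ht),
      ENNReal.toReal_add ENNReal.ofReal_ne_top (hpt x t), ENNReal.toReal_ofReal (hf0 x)] at this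
    linarith

end JumpRates

/-! ### Positivity of the transition function -/

theorem setLIntegral_Icc_add (F : ℝ → ℝ≥0∞) {s t : ℝ} (hs : 0 ≤ s) (ht : 0 ≤ t) :
    ∫⁻ u in Icc (0 : ℝ) (s + t), F u =
      (∫⁻ u in Icc (0 : ℝ) s, F u) + ∫⁻ u in Icc (0 : ℝ) t, F (s + u) := by
  have e : ∫⁻ u in Icc (0 : ℝ) t, F (s + u) = ∫⁻ u in Icc s (s + t), F u := by
    rw [← lintegral_indicator measurableSet_Icc, ← lintegral_indicator measurableSet_Icc,
      ← lintegral_add_left_eq_self ((Icc s (s + t)).indicator F) s]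
    congr 1 with u
    simp [indicator, mem_Icc]
  rw [e, ← setLIntegral_congr (Ioc_ae_eq_Icc (a := s)), ← lintegral_union measurableSet_Ioc,
    Icc_union_Ioc_eq_Icc hs (by linarith)]
  exact disjoint_left.2 fun u h1 h2 => absurd h1.2 (not_le.2 h2.1)

namespace JumpRates

variable {S : Type} {q : JumpRates S}

/-- Waiting for a time `s` at `x` without jumping, then following the chain for a time `t`. -/
theorem transAux_hold_add (n : ℕ) {s t : ℝ} (hs : 0 ≤ s) (ht : 0 ≤ t) (x y : S) :
    (∫⁻ u in Icc (0 : ℝ) s, q.hold x u *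
        ∑' z, (q.rate x z : ℝ≥0∞) * q.transAux n (s + t - u) z y) +
      q.hold x s * q.transAux (n + 1) t x y ≤ q.transAux (n + 1) (s + t) x y := by
  rw [transAux_succ, transAux_succ, setLIntegral_Icc_add _ hs ht, hold_add, mul_add,
    ← lintegral_const_mul' _ _ (q.hold_ne_top x s)]
  refine le_of_eq ?_
  simp_rw [hold_add, show ∀ u, s + t - (s + u) = t - u by intro u; ring]
  simp_rw [mul_assoc]
  ring

theorem hold_le_trans (t : ℝ) (x : S) : q.hold x t ≤ q.trans t x x := by
  refine le_trans ?_ (q.transAux_le_trans 1 t x x)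
  rw [transAux_succ]
  simp

variable (q) in
/-- Every positive time gives positive probability to `y` for the chain started at `x`. -/
def Reaches (x y : S) : Prop := ∀ t : ℝ, 0 < t → 0 < q.trans t x y

theorem Reaches.refl (x : S) : q.Reaches x x := fun t _ =>
  (q.hold_pos x t).trans_le (hold_le_trans t x)

variable [Countable S]

theorem transAux_mul_transAux_le (n k : ℕ) {s t : ℝ} (hs : 0 ≤ s) (ht : 0 ≤ t) (x y z : S) :
    q.transAux n s x y * q.transAux k t y z ≤ q.transAux (n + k) (s + t) x z := by
  classical
  induction n generalizing s x with
  | zero => simp [transAux]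
  | succ n ih =>
    have h1 : q.hold x s * indicator {y} 1 x * q.transAux k t y z ≤
        q.hold x s * q.transAux (n + k + 1) t x z := by
      by_cases h : x = y
      · subst h
        simp only [mem_singleton_iff, indicator_of_mem, Pi.one_apply, mul_one]
        gcongr
        exact q.monotone_transAux t x z (by omega)
      · simp [h]
    have hm : Measurable fun u => q.hold x u *
        ∑' w, (q.rate x w : ℝ≥0∞) * q.transAux n (s - u) w y :=
      (q.measurable_hold x).mul (Measurable.tsum fun w =>
        measurable_const.mul ((q.measurable_transAux n w y).comp
          (measurable_const.sub measurable_id)))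
    have h2 : (∫⁻ u in Icc (0 : ℝ) s, q.hold x u *
        ∑' w, (q.rate x w : ℝ≥0∞) * q.transAux n (s - u) w y) * q.transAux k t y z ≤
        ∫⁻ u in Icc (0 : ℝ) s, q.hold x u *
          ∑' w, (q.rate x w : ℝ≥0∞) * q.transAux (n + k) (s + t - u) w z := by
      rw [← lintegral_mul_const _ hm]
      refine setLIntegral_mono' measurableSet_Icc fun u hu => ?_
      rw [mul_assoc, ← ENNReal.tsum_mul_right]
      refine mul_le_mul_right (ENNReal.tsum_le_tsum fun w => ?_) _
      rw [mul_assoc]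
      refine mul_le_mul_right ?_ _
      rw [show s + t - u = s - u + t by ring]
      exact ih (by linarith [hu.2]) w
    rw [transAux_succ, add_mul, add_comm, show n + 1 + k = n + k + 1 by ring]
    exact (add_le_add h2 h1).trans (transAux_hold_add (n + k) hs ht x z)

/-- Supermultiplicativity: the easy half of the Chapman-Kolmogorov equation. -/
theorem trans_mul_trans_le {s t : ℝ} (hs : 0 ≤ s) (ht : 0 ≤ t) (x y z : S) :
    q.trans s x y * q.trans t y z ≤ q.trans (s + t) x z := by
  unfold trans
  simp_rw [ENNReal.iSup_mul, ENNReal.mul_iSup]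
  exact iSup₂_le fun n k => (transAux_mul_transAux_le n k hs ht x y z).trans
    (le_iSup (fun n => q.transAux n (s + t) x z) _)

theorem Reaches.trans {x y z : S} (h1 : q.Reaches x y) (h2 : q.Reaches y z) : q.Reaches x z := by
  intro t ht
  have h := trans_mul_trans_le (q := q) (half_pos ht).le (half_pos ht).le x y z
  rw [add_halves] at h
  exact (ENNReal.mul_pos (h1 _ (half_pos ht)).ne' (h2 _ (half_pos ht)).ne').trans_le h

theorem Reaches.of_rate_pos {x y : S} (h : 0 < q.rate x y) : q.Reaches x y := by
  intro t ht
  refine lt_of_lt_of_le ?_ (q.transAux_le_trans 2 t x y)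
  rw [transAux_succ]
  refine lt_of_lt_of_le ?_ (le_add_left le_rfl)
  have hm : Measurable fun u => q.hold x u *
      ∑' w, (q.rate x w : ℝ≥0∞) * q.transAux 1 (t - u) w y :=
    (q.measurable_hold x).mul (Measurable.tsum fun w =>
      measurable_const.mul ((q.measurable_transAux 1 w y).comp
        (measurable_const.sub measurable_id)))
  rw [pos_iff_ne_zero, Ne, lintegral_eq_zero_iff hm]
  have hpos : ∀ u, q.hold x u * ∑' w, (q.rate x w : ℝ≥0∞) * q.transAux 1 (t - u) w y ≠ 0 := by
    intro u
    refine mul_ne_zero (q.hold_pos x u).ne' fun h0 => ?_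
    have := ENNReal.tsum_eq_zero.1 h0 y
    rw [mul_eq_zero] at this
    rcases this with h1 | h1
    · exact h.ne' (by exact_mod_cast h1)
    · rw [transAux_succ] at h1
      simp [(q.hold_pos y (t - u)).ne'] at h1
  intro h0
  rw [Filter.EventuallyEq, ae_iff] at h0
  simp [hpos, ht.not_ge] at h0

/-! ### Small sets and survival -/

variable [MeasurableSpace S] [DiscreteMeasurableSpace S]

theorem law_apply (t : ℝ) (x : S) (A : Set S) : q.law t x A = q.mean (A.indicator 1) t x := by
  rw [← lintegral_law, lintegral_indicator_one (MeasurableSet.of_discrete)]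

theorem trans_le_law (t : ℝ) (x : S) {y : S} {A : Set S} (hy : y ∈ A) :
    q.trans t x y ≤ q.law t x A := by
  rw [law_apply, mean]
  simpa [hy] using ENNReal.le_tsum (f := fun y => q.trans t x y * A.indicator 1 y) y

/-- A finite set of communicating points is small, with a point mass as the minorizing measure. -/
theorem isSmallSet_of_reaches {K : Set S} (hK : K.Finite) (hne : K.Nonempty)
    (h : ∀ x ∈ K, ∀ y ∈ K, q.Reaches x y) : IsSmallSet q.law K := by
  obtain ⟨y, hy⟩ := hne
  obtain ⟨x, hx, hmin⟩ := exists_min_image K (fun x => q.trans 1 x y) hK ⟨y, hy⟩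
  obtain ⟨α, hα, hα'⟩ := ENNReal.lt_iff_exists_nnreal_btwn.1 (h x hx y hy 1 one_pos)
  refine ⟨1, one_pos, α, by exact_mod_cast hα, Measure.dirac y, inferInstance, by simp [hy],
    fun z hz A _ => ?_⟩
  by_cases hA : y ∈ A
  · simpa [hA, hy] using (hα'.le.trans (hmin z hz)).trans (trans_le_law 1 z hA)
  · simp [hA]

/-- The survival probability of a chain absorbed at `pt` is nonincreasing in time. -/
theorem law_compl_antitone {pt : S} (habs : ∀ y, q.rate pt y = 0) (hq : q.NonExplosive)
    {s t : ℝ} (hs : 0 ≤ s) (ht : 0 ≤ t) (x : S) :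
    q.law (s + t) x {pt}ᶜ ≤ q.law s x {pt}ᶜ := by
  have := hq s hs x
  have := hq (s + t) (add_nonneg hs ht) x
  rw [prob_compl_eq_one_sub .of_discrete, prob_compl_eq_one_sub .of_discrete]
  refine tsub_le_tsub_left ?_ _
  have e : ∀ r, q.law r x {pt} = q.trans r x pt := by
    intro r
    rw [law_apply, mean, tsum_eq_single pt]
    · simp
    · intro y hy
      simp [hy]
  have h1 : q.hold pt t = 1 := by simp [hold, exitRate, habs]
  rw [e, e]
  calc q.trans s x pt = q.trans s x pt * q.hold pt t := by rw [h1, mul_one]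
    _ ≤ q.trans s x pt * q.trans t pt pt := by gcongr; exact hold_le_trans t pt
    _ ≤ _ := trans_mul_trans_le hs ht x pt pt

theorem trans_mul_law_le {s t : ℝ} (hs : 0 ≤ s) (ht : 0 ≤ t) (x y : S) (A : Set S) :
    q.trans s x y * q.law t y A ≤ q.law (s + t) x A := by
  rw [law_apply, law_apply, mean, mean, ← ENNReal.tsum_mul_left]
  refine ENNReal.tsum_le_tsum fun z => ?_
  rw [← mul_assoc]
  gcongr
  exact trans_mul_trans_le hs ht x y z

/-- If the points of a finite set communicate, their survival probabilities are comparable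
uniformly in time: survival from `x` up to time `t` is at least as likely as being at `y` at
time `1` and then surviving for a time `t`. -/
theorem survival_ratio_pos {pt : S} (habs : ∀ y, q.rate pt y = 0) (hq : q.NonExplosive)
    {K : Set {x : S // x ≠ pt}} (hK : K.Finite) (hne : K.Nonempty)
    (h : ∀ x ∈ K, ∀ y ∈ K, q.Reaches x.1 y.1) :
    0 < ⨅ t : {t : ℝ // 0 ≤ t},
      (⨅ x : K, q.law t.1 x.1.1 {pt}ᶜ) / (⨆ x : K, q.law t.1 x.1.1 {pt}ᶜ) := by
  obtain ⟨p, hp, hmin⟩ := exists_min_image (K ×ˢ K) (fun p => q.trans 1 p.1.1 p.2.1)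
    (hK.prod hK) (hne.prod hne)
  refine (h p.1 hp.1 p.2 hp.2 1 one_pos).trans_le (le_iInf fun t => ?_)
  obtain ⟨x₀, hx₀⟩ := hne
  have hsup0 : (⨆ x : K, q.law t.1 x.1.1 {pt}ᶜ) ≠ 0 := by
    refine (lt_of_lt_of_le (q.hold_pos x₀.1 t.1) ?_).ne'
    refine le_trans ?_ (le_iSup (fun x : K => q.law t.1 x.1.1 {pt}ᶜ) ⟨x₀, hx₀⟩)
    exact (hold_le_trans t.1 x₀.1).trans (trans_le_law t.1 x₀.1 x₀.2)
  have hsup : (⨆ x : K, q.law t.1 x.1.1 {pt}ᶜ) ≠ ∞ := by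
    refine ne_top_of_le_ne_top ENNReal.one_ne_top (iSup_le fun x => ?_)
    have := hq t.1 t.2 x.1.1
    exact prob_le_one
  rw [ENNReal.le_div_iff_mul_le (Or.inl hsup0) (Or.inl hsup), ENNReal.mul_iSup]
  refine iSup_le fun y => le_iInf fun x => ?_
  calc q.trans 1 p.1.1 p.2.1 * q.law t.1 y.1.1 {pt}ᶜ
      ≤ q.trans 1 x.1.1 y.1.1 * q.law t.1 y.1.1 {pt}ᶜ := by
        gcongr
        exact hmin (x.1, y.1) ⟨x.2, y.2⟩
    _ ≤ q.law (1 + t.1) x.1.1 {pt}ᶜ := trans_mul_law_le zero_le_one t.2 _ _ _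
    _ ≤ q.law t.1 x.1.1 {pt}ᶜ := by
        rw [add_comm]
        exact law_compl_antitone habs hq t.2 zero_le_one _

end JumpRates

/-! ### Drift conditions -/

theorem exists_le_add_const {α : Type*} {f g : α → ℝ} (h : {x | ¬ f x ≤ g x}.Finite) :
    ∃ C : ℝ, 0 ≤ C ∧ ∀ x, f x ≤ g x + C := by
  obtain ⟨C, hC⟩ := (h.image fun x => f x - g x).bddAbove
  refine ⟨max C 0, le_max_right _ _, fun x => ?_⟩
  by_cases hx : f x ≤ g x
  · linarith [le_max_right C 0]
  · have := hC (mem_image_of_mem (fun x => f x - g x) hx)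
    linarith [le_max_left C 0]

theorem ENNReal.sum_coe_eq_ofReal {ι : Type*} [Fintype ι] (a : ι → ℝ≥0) :
    ∑ i, (a i : ℝ≥0∞) = ENNReal.ofReal (∑ i, (a i : ℝ)) := by
  rw [← ENNReal.ofNNReal_finsetSum, ← ENNReal.ofReal_coe_nnreal, NNReal.coe_sum]

theorem ENNReal.ofReal_add_ofReal_neg_eq {a b u : ℝ} (ha : 0 ≤ a) (hb : 0 ≤ b) (h : a - b = u) :
    ENNReal.ofReal a + ENNReal.ofReal (-u) = ENNReal.ofReal b + ENNReal.ofReal u := by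
  rcases le_total 0 u with hu | hu
  · rw [ENNReal.ofReal_of_nonpos (neg_nonpos.2 hu), add_zero, ← ENNReal.ofReal_add hb hu]
    congr 1
    linarith
  · rw [ENNReal.ofReal_of_nonpos hu, add_zero, ← ENNReal.ofReal_add ha (neg_nonneg.2 hu)]
    congr 1
    linarith

namespace JumpRates

variable {S : Type} {q : JumpRates S}

variable (q) in
/-- `U` is the image of `f` under the generator of the chain, pointwise. Only meant for `f ≥ 0`,
since negative values are replaced by `0`. -/
def HasDrift (f U : S → ℝ) : Prop :=
  q.GeneratorEq (fun x => ENNReal.ofReal (f x)) (fun x => ENNReal.ofReal (U x))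
    (fun x => ENNReal.ofReal (-U x))

theorem HasDrift.growthBound {f U : S → ℝ} {C : ℝ} (h : q.HasDrift f U) (hU : ∀ x, U x ≤ C)
    (h1 : ∀ x, 1 ≤ f x) : q.GrowthBound C.toNNReal fun x => ENNReal.ofReal (f x) where
  ne_top x := ENNReal.ofReal_ne_top
  drift x := by
    refine (le_self_add.trans (h x).le).trans ?_
    rw [ENNReal.coe_add, add_mul]
    gcongr
    calc ENNReal.ofReal (U x) ≤ ENNReal.ofReal C * 1 := by
          rw [mul_one]
          exact ENNReal.ofReal_le_ofReal (hU x)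
      _ ≤ ENNReal.ofReal C * ENNReal.ofReal (f x) := by
          gcongr
          simpa using h1 x

theorem HasDrift.stopped {f U : S → ℝ} (h : q.HasDrift f U) (K : Set S) :
    (q.stopped K).HasDrift f (K.indicator U) := by
  intro x
  by_cases hx : x ∈ K
  · simpa [JumpRates.stopped, exitRate, hx] using h x
  · simp [JumpRates.stopped, exitRate, hx]

end JumpRates

section Size

variable {d : ℕ}

theorem size_eq_zero {x : Fin d → ℕ} : size x = 0 ↔ x = 0 := by
  simp [size, funext_iff]

theorem size_add (x y : Fin d → ℕ) : size (x + y) = size x + size y := by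
  simp [size, Finset.sum_add_distrib]

theorem size_single (i : Fin d) : size (Pi.single i 1 : Fin d → ℕ) = 1 := by
  simp [size]

theorem finite_size_lt (N : ℕ) : {x : Fin d → ℕ | size x < N}.Finite := by
  refine (Set.finite_Iic (fun _ : Fin d => N)).subset fun x hx i => ?_
  exact (Finset.single_le_sum (f := x) (fun _ _ => Nat.zero_le _) (Finset.mem_univ i)).trans
    (le_of_lt hx)

theorem finite_subtype_size_lt (N : ℕ) : {x : {x : Fin d → ℕ // x ≠ 0} | size x.1 < N}.Finite :=
  (finite_size_lt N).preimage Subtype.val_injective.injOn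

theorem one_le_size (x : {x : Fin d → ℕ // x ≠ 0}) : 1 ≤ size x.1 :=
  Nat.one_le_iff_ne_zero.2 fun h => x.2 (size_eq_zero.1 h)

theorem eventually_comap_size {P : (Fin d → ℕ) → Prop} :
    (∀ᶠ x in comap size atTop, P x) ↔ ∃ N, ∀ x, N ≤ size x → P x := by
  rw [eventually_comap, eventually_atTop]
  constructor
  · rintro ⟨N, hN⟩
    exact ⟨N, fun x hx => hN _ hx x rfl⟩
  · rintro ⟨N, hN⟩
    exact ⟨N, fun n hn x hx => hN x (hx ▸ hn)⟩

theorem dominated_of_isLittleO {α : Type} {s : α → ℕ} (hs : ∀ N, {x | s x < N}.Finite)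
    {φ ψ : ℕ → ℝ} (h : φ =o[atTop] ψ) (hψ : ∀ n, 0 ≤ ψ n) :
    JumpRates.Dominated (fun x => ENNReal.ofReal (φ (s x)))
      (fun x => ENNReal.ofReal (ψ (s x))) := by
  intro ε hε
  obtain ⟨N, hN⟩ := eventually_atTop.1 (h.bound (c := (ε : ℝ)) hε)
  refine (hs N).subset fun x hx => ?_
  by_contra hlt
  have := hN (s x) (not_lt.1 hlt)
  rw [Real.norm_eq_abs, Real.norm_of_nonneg (hψ _)] at this
  simp only [mem_ofPred_eq] at hx
  refine not_le.2 hx ?_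
  rw [← ENNReal.ofReal_coe_nnreal, ← ENNReal.ofReal_mul ε.coe_nonneg]
  exact ENNReal.ofReal_le_ofReal ((le_abs_self _).trans this)

/-- Any two nonzero points of `ℕ^d` are joined by a path of unit steps that avoids the origin:
`x → x + y → y`. -/
theorem rel_of_rel_add_single {R : {x : Fin d → ℕ // x ≠ 0} → {x : Fin d → ℕ // x ≠ 0} → Prop}
    (hrefl : ∀ x, R x x) (htrans : ∀ x y z, R x y → R y z → R x z)
    (hstep : ∀ x y i, y.1 = x.1 + Pi.single i 1 → R x y ∧ R y x)
    (x y : {x : Fin d → ℕ // x ≠ 0}) : R x y := by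
  have key : ∀ n, ∀ v : Fin d → ℕ, size v = n → ∀ x y : {x : Fin d → ℕ // x ≠ 0},
      y.1 = x.1 + v → R x y ∧ R y x := by
    intro n
    induction n with
    | zero =>
      intro v hv x y hxy
      have : y = x := Subtype.ext (by rw [hxy, size_eq_zero.1 hv, add_zero])
      subst this
      exact ⟨hrefl y, hrefl y⟩
    | succ n ih =>
      intro v hv x y hxy
      have hv0 : v ≠ 0 := fun h => by simp [size_eq_zero.2 h] at hv
      obtain ⟨i, hi⟩ := Function.ne_iff.1 hv0
      have hvi : v = (v - Pi.single i 1) + Pi.single i 1 := by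
        refine (tsub_add_cancel_of_le fun j => ?_).symm
        rcases eq_or_ne j i with rfl | hj
        · simpa using Nat.one_le_iff_ne_zero.2 hi
        · simp [hj]
      have hz : x.1 + (v - Pi.single i 1) ≠ 0 := fun h => x.2 (add_eq_zero.1 h).1
      have h1 := ih (v - Pi.single i 1) (by
        have := congrArg size hvi
        rw [size_add, size_single] at this
        omega) x ⟨_, hz⟩ rfl
      have h2 := hstep ⟨_, hz⟩ y i (by rw [hxy, add_assoc, ← hvi])
      exact ⟨htrans _ _ _ h1.1 h2.1, htrans _ _ _ h2.2 h1.2⟩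
  have hz : x.1 + y.1 ≠ 0 := fun h => x.2 (add_eq_zero.1 h).1
  exact htrans x ⟨_, hz⟩ y (key _ y.1 rfl x ⟨_, hz⟩ rfl).1
    (key _ x.1 rfl y ⟨_, hz⟩ (add_comm _ _)).2

end Size

/-! ### The birth and death process -/

section BirthDeath

variable {d : ℕ} {b m : Fin d → (Fin d → ℕ) → ℝ≥0}

/-- The rate at which `φ(|Y|)` increases on average from `x`, that is, the generator of `Y` applied
to `φ(|x|)`. -/
noncomputable def sizeDrift (b m : Fin d → (Fin d → ℕ) → ℝ≥0) (φ : ℕ → ℝ) (x : Fin d → ℕ) : ℝ :=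
  (∑ i, (b i x : ℝ)) * (φ (size x + 1) - φ (size x)) -
    (∑ i, (m i x : ℝ)) * (φ (size x) - φ (size x - 1))

theorem tsum_birthDeath_rate (hm_zero : ∀ i x, x i = 0 → m i x = 0) (F : ℕ → ℝ≥0∞)
    (x : Fin d → ℕ) :
    ∑' y, ((birthDeath b m).rate x y : ℝ≥0∞) * F (size y) =
      (∑ i, (b i x : ℝ≥0∞)) * F (size x + 1) + (∑ i, (m i x : ℝ≥0∞)) * F (size x - 1) := by
  have e : ∀ y, ((birthDeath b m).rate x y : ℝ≥0∞) * F (size y) =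
      ∑ i, ((if y = x + Pi.single i 1 then (b i x : ℝ≥0∞) * F (size y) else 0) +
        (if x = y + Pi.single i 1 then (m i x : ℝ≥0∞) * F (size y) else 0)) := by
    intro y
    rw [birthDeath, ENNReal.ofNNReal_finsetSum, Finset.sum_mul]
    refine Finset.sum_congr rfl fun i _ => ?_
    rw [ENNReal.coe_add, add_mul]
    congr 1 <;> split_ifs <;> simp
  simp_rw [e]
  rw [Summable.tsum_finsetSum fun i _ => ENNReal.summable, Finset.sum_mul, Finset.sum_mul,
    ← Finset.sum_add_distrib]
  refine Finset.sum_congr rfl fun i _ => ?_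
  rw [ENNReal.tsum_add]
  congr 1
  · rw [tsum_eq_single (x + Pi.single i 1) fun y hy => if_neg hy, if_pos rfl, size_add, size_single]
  · by_cases hx : x i = 0
    · simp [hm_zero i x hx]
    have hxi : x - Pi.single i 1 + Pi.single i 1 = x := by
      refine tsub_add_cancel_of_le fun j => ?_
      rcases eq_or_ne j i with rfl | hj
      · simpa using Nat.one_le_iff_ne_zero.2 hx
      · simp [hj]
    rw [tsum_eq_single (x - Pi.single i 1), if_pos hxi.symm]
    · have := congrArg size hxi
      rw [size_add, size_single] at this
      rw [← this, Nat.add_sub_cancel]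
    · intro y hy
      refine if_neg fun h => hy ?_
      rw [h, add_tsub_cancel_right]

theorem tsum_unkilled_rate (hm_zero : ∀ i x, x i = 0 → m i x = 0) (F : ℕ → ℝ≥0∞)
    (x : {x : Fin d → ℕ // x ≠ 0}) :
    ∑' y : {x : Fin d → ℕ // x ≠ 0}, (((birthDeath b m).unkilled 0).rate x y : ℝ≥0∞) *
      F (size y.1) =
      (∑ i, (b i x.1 : ℝ≥0∞)) * F (size x.1 + 1) +
        (∑ i, (m i x.1 : ℝ≥0∞)) * (if size x.1 - 1 = 0 then 0 else F (size x.1 - 1)) := by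
  have h := tsum_birthDeath_rate (b := b) hm_zero (fun n => if n = 0 then 0 else F n) x.1
  rw [if_neg (Nat.succ_ne_zero _)] at h
  rw [← h]
  have e : ∀ y : Fin d → ℕ, ((birthDeath b m).rate x.1 y : ℝ≥0∞) *
      (if size y = 0 then 0 else F (size y)) = {y : Fin d → ℕ | y ≠ 0}.indicator
        (fun y => ((birthDeath b m).rate x.1 y : ℝ≥0∞) * F (size y)) y := by
    intro y
    by_cases hy : y = 0 <;> simp [hy, size_eq_zero, indicator]
  simp_rw [e]
  exact tsum_subtype {y : Fin d → ℕ | y ≠ 0}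
    (fun y => ((birthDeath b m).rate x.1 y : ℝ≥0∞) * F (size y))

theorem birthDeath_hasDrift (hm_zero : ∀ i x, x i = 0 → m i x = 0) {φ : ℕ → ℝ}
    (hφ : ∀ n, 0 ≤ φ n) :
    (birthDeath b m).HasDrift (fun x => φ (size x)) (sizeDrift b m φ) := by
  intro x
  have hx := tsum_birthDeath_rate (b := b) hm_zero 1 x
  simp only [Pi.one_apply, mul_one, ← JumpRates.coe_exitRate] at hx
  rw [tsum_birthDeath_rate hm_zero (fun n => ENNReal.ofReal (φ n)), hx]
  simp only [ENNReal.sum_coe_eq_ofReal]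
  have hB : 0 ≤ ∑ i, (b i x : ℝ) := Finset.sum_nonneg fun i _ => (b i x).2
  have hM : 0 ≤ ∑ i, (m i x : ℝ) := Finset.sum_nonneg fun i _ => (m i x).2
  have h0 := hφ (size x)
  have h1 := hφ (size x + 1)
  have h2 := hφ (size x - 1)
  rw [← ENNReal.ofReal_mul hB, ← ENNReal.ofReal_mul hM, ← ENNReal.ofReal_add hB hM,
    ← ENNReal.ofReal_add (by positivity) (by positivity), ← ENNReal.ofReal_mul (by positivity)]
  refine ENNReal.ofReal_add_ofReal_neg_eq (by positivity) (by positivity) ?_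
  rw [sizeDrift]
  ring

/-- Suppressing the jumps to the origin amounts to giving `φ` the same value at `0` as at `1`. -/
theorem unkilled_hasDrift (hm_zero : ∀ i x, x i = 0 → m i x = 0) {φ : ℕ → ℝ}
    (hφ : ∀ n, 0 ≤ φ n) :
    ((birthDeath b m).unkilled 0).HasDrift (fun x => φ (size x.1))
      (fun x => sizeDrift b m (fun n => φ (max n 1)) x.1) := by
  intro x
  have hx := tsum_unkilled_rate (b := b) hm_zero 1 x
  simp only [Pi.one_apply, mul_one, ← JumpRates.coe_exitRate] at hx
  rw [tsum_unkilled_rate hm_zero (fun n => ENNReal.ofReal (φ n)), hx]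
  simp only [ENNReal.sum_coe_eq_ofReal]
  have hB : 0 ≤ ∑ i, (b i x.1 : ℝ) := Finset.sum_nonneg fun i _ => (b i x.1).2
  have hM : 0 ≤ ∑ i, (m i x.1 : ℝ) := Finset.sum_nonneg fun i _ => (m i x.1).2
  have h0 := hφ (size x.1)
  have h1 := hφ (size x.1 + 1)
  have h2 := hφ (size x.1 - 1)
  have hn := one_le_size x
  rw [sizeDrift, max_eq_left hn, max_eq_left (by omega : 1 ≤ size x.1 + 1)]
  by_cases h : size x.1 - 1 = 0
  · rw [if_pos h, if_pos h, mul_zero, add_zero, add_zero, h, ← ENNReal.ofReal_mul hB,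
      ← ENNReal.ofReal_mul hB]
    refine ENNReal.ofReal_add_ofReal_neg_eq (by positivity) (by positivity) ?_
    rw [show size x.1 = 1 by omega]
    simp
    ring
  · rw [if_neg h, if_neg h, mul_one, ← ENNReal.ofReal_mul hB, ← ENNReal.ofReal_mul hM,
      ← ENNReal.ofReal_add hB hM, ← ENNReal.ofReal_add (by positivity) (by positivity),
      ← ENNReal.ofReal_mul (by positivity), max_eq_left (by omega)]
    refine ENNReal.ofReal_add_ofReal_neg_eq (by positivity) (by positivity) ?_
    ring

theorem sizeDrift_max_of_two_le (φ : ℕ → ℝ) {x : Fin d → ℕ} (hx : 2 ≤ size x) :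
    sizeDrift b m (fun n => φ (max n 1)) x = sizeDrift b m φ x := by
  rw [sizeDrift, sizeDrift, max_eq_left (by omega), max_eq_left (by omega), max_eq_left (by omega)]

theorem birthDeath_rate_add_single_pos (hb_pos : ∀ i x, x ≠ 0 → 0 < b i x) {x : Fin d → ℕ}
    (hx : x ≠ 0) (i : Fin d) : 0 < (birthDeath b m).rate x (x + Pi.single i 1) := by
  refine Finset.sum_pos' (fun _ _ => zero_le) ⟨i, Finset.mem_univ i, ?_⟩
  rw [if_pos rfl]
  exact add_pos_of_pos_of_nonneg (hb_pos i x hx) zero_le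

theorem birthDeath_rate_sub_single_pos (hm_pos : ∀ i x, 1 ≤ x i → 0 < m i x) (x : Fin d → ℕ)
    (i : Fin d) : 0 < (birthDeath b m).rate (x + Pi.single i 1) x := by
  refine Finset.sum_pos' (fun _ _ => zero_le) ⟨i, Finset.mem_univ i, ?_⟩
  rw [if_pos rfl]
  exact add_pos_of_nonneg_of_pos zero_le (hm_pos i _ (by simp))

theorem birthDeath_reaches (hb_pos : ∀ i x, x ≠ 0 → 0 < b i x)
    (hm_pos : ∀ i x, 1 ≤ x i → 0 < m i x) (x y : {x : Fin d → ℕ // x ≠ 0}) :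
    (birthDeath b m).Reaches x.1 y.1 := by
  refine rel_of_rel_add_single (R := fun x y => (birthDeath b m).Reaches x.1 y.1)
    (fun x => .refl x.1) (fun x y z h1 h2 => h1.trans h2) (fun x y i h => ?_) x y
  rw [h]
  exact ⟨.of_rate_pos (birthDeath_rate_add_single_pos hb_pos x.2 i),
    .of_rate_pos (birthDeath_rate_sub_single_pos hm_pos x.1 i)⟩

theorem unkilled_reaches (hb_pos : ∀ i x, x ≠ 0 → 0 < b i x)
    (hm_pos : ∀ i x, 1 ≤ x i → 0 < m i x) (x y : {x : Fin d → ℕ // x ≠ 0}) :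
    ((birthDeath b m).unkilled 0).Reaches x y := by
  refine rel_of_rel_add_single (R := ((birthDeath b m).unkilled 0).Reaches)
    (fun x => .refl x) (fun x y z h1 h2 => h1.trans h2) (fun x y i h => ?_) x y
  constructor
  · refine .of_rate_pos ?_
    change 0 < (birthDeath b m).rate x.1 y.1
    rw [h]
    exact birthDeath_rate_add_single_pos hb_pos x.2 i
  · refine .of_rate_pos ?_
    change 0 < (birthDeath b m).rate y.1 x.1
    rw [h]
    exact birthDeath_rate_sub_single_pos hm_pos x.1 i

theorem killing_birthDeath_eq_zero {x : {x : Fin d → ℕ // x ≠ 0}} (hx : ¬ size x.1 < 2) :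
    (birthDeath b m).killing 0 x = 0 := by
  simp only [JumpRates.killing, birthDeath]
  refine Finset.sum_eq_zero fun i _ => ?_
  rw [if_neg, if_neg, add_zero]
  · intro h
    have := congrArg size h
    rw [size_add, size_single] at this
    have h0 : size (0 : Fin d → ℕ) = 0 := size_eq_zero.2 rfl
    omega
  · intro h
    exact x.2 (add_eq_zero.1 h.symm).1

theorem bddAbove_killing_birthDeath : BddAbove (range ((birthDeath b m).killing 0)) := by
  refine (((finite_subtype_size_lt 2).image ((birthDeath b m).killing 0)).union
    (finite_singleton 0)).bddAbove.mono ?_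
  rintro _ ⟨x, rfl⟩
  by_cases hx : size x.1 < 2
  · exact Or.inl ⟨x, hx, rfl⟩
  · exact Or.inr (killing_birthDeath_eq_zero hx)

/-- A drift bound that holds far from the origin yields an upper bound everywhere for the
generator of `X`. -/
theorem exists_unkilled_drift_le {φ g : ℕ → ℝ} {N : ℕ}
    (h : ∀ x : Fin d → ℕ, N ≤ size x → sizeDrift b m φ x ≤ g (size x)) :
    ∃ C : ℝ, 0 ≤ C ∧ ∀ x : {x : Fin d → ℕ // x ≠ 0},
      sizeDrift b m (fun n => φ (max n 1)) x.1 ≤ g (size x.1) + C := by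
  refine exists_le_add_const ((finite_subtype_size_lt (max N 2)).subset fun x hx => ?_)
  by_contra hlt
  simp only [mem_ofPred_eq, not_lt, max_le_iff] at hlt
  refine hx ?_
  rw [sizeDrift_max_of_two_le _ hlt.2]
  exact h _ hlt.1

theorem exists_drift_le {φ g : ℕ → ℝ} {N : ℕ}
    (h : ∀ x : Fin d → ℕ, N ≤ size x → sizeDrift b m φ x ≤ g (size x)) :
    ∃ C : ℝ, 0 ≤ C ∧ ∀ x, sizeDrift b m φ x ≤ g (size x) + C := by
  refine exists_le_add_const ((finite_size_lt N).subset fun x hx => ?_)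
  by_contra hlt
  exact hx (h _ (not_lt.1 hlt))

theorem lyapunovBound_size {φ : ℕ → ℝ} {lam : ℝ} {N : ℕ}
    (hlam : ((⨆ x, (birthDeath b m).killing 0 x : ℝ≥0) : ℝ) < lam)
    (h : ∀ x : Fin d → ℕ, N ≤ size x → sizeDrift b m φ x ≤ -lam * φ (size x))
    (hφ : ∀ n, 1 ≤ n → 1 ≤ φ n) (hφt : Tendsto φ atTop atTop) :
    LyapunovBound ((birthDeath b m).killing 0) (fun x => φ (size x.1))
      (fun x => sizeDrift b m (fun n => φ (max n 1)) x.1) where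
  one_le x := hφ _ (one_le_size x)
  locally_bounded x := ⟨{x}, by simp, by simp⟩
  level_sets c := by
    obtain ⟨N, hN⟩ := eventually_atTop.1 (hφt.eventually_gt_atTop c)
    have hfin : {x : {x : Fin d → ℕ // x ≠ 0} | φ (size x.1) ≤ c}.Finite := by
      refine (finite_subtype_size_lt N).subset fun x hx => ?_
      by_contra hlt
      exact not_lt.2 hx (hN _ (not_lt.1 hlt))
    exact hfin.isCompact.closure
  drift := by
    obtain ⟨C, -, hC⟩ := exists_unkilled_drift_le (g := fun n => -lam * φ n) h
    exact ⟨lam, C, hlam, hC⟩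

/-- `φ(|x|)` lies in the extended domain of the generator of `X` when it is negligible with respect
to some `ψ(|x|)`, and both have negative drift far from the origin. -/
theorem unkilled_inExtendedDomain (hm_zero : ∀ i x, x i = 0 → m i x = 0) {φ ψ : ℕ → ℝ} {N : ℕ}
    (hφ0 : ∀ n, 0 ≤ φ n) (hφ : ∀ n, 1 ≤ n → 1 ≤ φ n)
    (hψ0 : ∀ n, 0 ≤ ψ n) (hψ : ∀ n, 1 ≤ n → 1 ≤ ψ n)
    (hφN : ∀ x : Fin d → ℕ, N ≤ size x → sizeDrift b m φ x ≤ 0)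
    (hψN : ∀ x : Fin d → ℕ, N ≤ size x → sizeDrift b m ψ x ≤ 0) (hφψ : φ =o[atTop] ψ) :
    InExtendedDomain ((birthDeath b m).unkilled 0).law (fun x => φ (size x.1))
      (fun x => sizeDrift b m (fun n => φ (max n 1)) x.1) := by
  obtain ⟨C, -, hC⟩ := exists_unkilled_drift_le (g := 0) hφN
  obtain ⟨D, -, hD⟩ := exists_unkilled_drift_le (g := 0) hψN
  simp only [Pi.zero_apply, zero_add] at hC hD
  exact JumpRates.inExtendedDomain (unkilled_hasDrift hm_zero hφ0) hC
    ((unkilled_hasDrift hm_zero hψ0).growthBound hD fun x => hψ _ (one_le_size x))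
    (fun x => hφ _ (one_le_size x)) (dominated_of_isLittleO finite_subtype_size_lt hφψ hψ0)

/-- On stopping at the exit from a finite set the drift becomes bounded, and any faster growing
function, such as `|x|^2`, controls `|x|`. -/
theorem unkilled_inLocalExtendedDomain (hm_zero : ∀ i x, x i = 0 → m i x = 0) :
    InLocalExtendedDomain ((birthDeath b m).unkilled 0) (fun x => (size x.1 : ℝ))
      (fun x => sizeDrift b m (fun n => ((max n 1 : ℕ) : ℝ)) x.1) := by
  intro K hK
  have hKf := hK.finite_of_discrete
  have hbdd : ∀ U : {x : Fin d → ℕ // x ≠ 0} → ℝ, ∃ C, ∀ x, K.indicator U x ≤ C := by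
    intro U
    obtain ⟨C, -, hC⟩ := exists_le_add_const (f := K.indicator U) (g := 0)
      (hKf.subset fun x hx => by
        by_contra h
        exact hx (by simp [h]))
    exact ⟨C, fun x => by simpa using hC x⟩
  have h1 := (unkilled_hasDrift (b := b) hm_zero (φ := fun n => (n : ℝ))
    (fun n => n.cast_nonneg)).stopped K
  have h2 := (unkilled_hasDrift (b := b) hm_zero (φ := fun n => (n : ℝ) ^ 2)
    (fun n => by positivity)).stopped K
  obtain ⟨C, hC⟩ := hbdd fun x => sizeDrift b m (fun n => ((max n 1 : ℕ) : ℝ)) x.1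
  obtain ⟨D, hD⟩ := hbdd fun x => sizeDrift b m (fun n => ((max n 1 : ℕ) : ℝ) ^ 2) x.1
  have hs : ∀ x : {x : Fin d → ℕ // x ≠ 0}, (1 : ℝ) ≤ size x.1 := fun x => by
    exact_mod_cast one_le_size x
  refine JumpRates.inExtendedDomain h1 hC (h2.growthBound hD fun x => one_le_pow₀ (hs x)) hs
    (dominated_of_isLittleO (φ := fun n => (n : ℝ)) (ψ := fun n => (n : ℝ) ^ 2)
      finite_subtype_size_lt ?_ fun n => by positivity)
  have := (Asymptotics.isLittleO_pow_pow_atTop_of_lt (𝕜 := ℝ) one_lt_two).comp_tendsto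
    tendsto_natCast_atTop_atTop
  simpa [Function.comp_def] using this

theorem birthDeath_nonExplosive (hm_zero : ∀ i x, x i = 0 → m i x = 0) {ψ : ℕ → ℝ} {N : ℕ}
    (hψ : ∀ n, 1 ≤ ψ n) (hψN : ∀ x : Fin d → ℕ, N ≤ size x → sizeDrift b m ψ x ≤ 0)
    (hψt : Tendsto ψ atTop atTop) : (birthDeath b m).NonExplosive := by
  have h0 : ∀ n, 0 ≤ ψ n := fun n => zero_le_one.trans (hψ n)
  obtain ⟨D, -, hD⟩ := exists_drift_le (g := 0) hψN
  simp only [Pi.zero_apply, zero_add] at hD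
  refine ((birthDeath_hasDrift hm_zero h0).growthBound hD fun x => hψ _).nonExplosive ?_
  simpa [Pi.one_def] using dominated_of_isLittleO (φ := fun _ => 1) finite_size_lt
    ((Asymptotics.isLittleO_const_left).2 (Or.inr (tendsto_norm_atTop_atTop.comp hψt))) h0

theorem unkilled_nonExplosive (hm_zero : ∀ i x, x i = 0 → m i x = 0) {ψ : ℕ → ℝ} {N : ℕ}
    (hψ : ∀ n, 1 ≤ ψ n) (hψN : ∀ x : Fin d → ℕ, N ≤ size x → sizeDrift b m ψ x ≤ 0)
    (hψt : Tendsto ψ atTop atTop) : ((birthDeath b m).unkilled 0).NonExplosive := by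
  have h0 : ∀ n, 0 ≤ ψ n := fun n => zero_le_one.trans (hψ n)
  obtain ⟨D, -, hD⟩ := exists_unkilled_drift_le (g := 0) hψN
  simp only [Pi.zero_apply, zero_add] at hD
  refine ((unkilled_hasDrift hm_zero h0).growthBound hD fun x => hψ _).nonExplosive ?_
  simpa [Pi.one_def] using dominated_of_isLittleO (φ := fun _ => 1) finite_subtype_size_lt
    ((Asymptotics.isLittleO_const_left).2 (Or.inr (tendsto_norm_atTop_atTop.comp hψt))) h0

/-- Only the Lyapunov function is left to be found once some `ψ(|x|) → ∞` with eventually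
nonpositive drift rules out explosions. -/
theorem assumptionH_birthDeath (hb_pos : ∀ i x, x ≠ 0 → 0 < b i x) (hb_zero : ∀ i, b i 0 = 0)
    (hm_pos : ∀ i x, 1 ≤ x i → 0 < m i x) (hm_zero : ∀ i x, x i = 0 → m i x = 0)
    {ψ : ℕ → ℝ} {N : ℕ} (hψ : ∀ n, 1 ≤ ψ n)
    (hψN : ∀ x : Fin d → ℕ, N ≤ size x → sizeDrift b m ψ x ≤ 0) (hψt : Tendsto ψ atTop atTop)
    (hlyap : ∃ V U, InExtendedDomain ((birthDeath b m).unkilled 0).law V U ∧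
      LyapunovBound ((birthDeath b m).killing 0) V U) :
    AssumptionH (birthDeath b m) 0 := by
  have habs : ∀ y, (birthDeath b m).rate 0 y = 0 := fun y => by
    simp only [birthDeath]
    exact Finset.sum_eq_zero fun i _ => by simp [hb_zero, hm_zero i 0 rfl]
  have hY := birthDeath_nonExplosive hm_zero hψ hψN hψt
  exact {
    absorbing := habs
    nonExplosive := hY
    nonExplosive_unkilled := unkilled_nonExplosive hm_zero hψ hψN hψt
    killing_bounded := bddAbove_killing_birthDeath
    small_sets := fun K hK hne => JumpRates.isSmallSet_of_reaches hK.finite_of_discrete hne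
      fun x _ y _ => unkilled_reaches hb_pos hm_pos x y
    lyapunov := hlyap
    survival := fun K hK hne => JumpRates.survival_ratio_pos habs hY hK.finite_of_discrete hne
      fun x _ y _ => birthDeath_reaches hb_pos hm_pos x y }

/-! ### The two growth conditions -/

theorem sizeDrift_natCast {x : Fin d → ℕ} (hx : 1 ≤ size x) (c : ℝ) :
    sizeDrift b m (fun n => (n : ℝ) + c) x = ∑ i, (b i x : ℝ) - ∑ i, (m i x : ℝ) := by
  rw [sizeDrift, Nat.cast_sub hx]
  push_cast
  ring

/-- By concavity the increment of `√` to the left of `n` is at least the one to the right, and it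
is at least `1 / (2 √n)`. -/
theorem sizeDrift_sqrt_le {x : Fin d → ℕ} (hx : 1 ≤ size x) {L : ℝ} (hL : 0 ≤ L)
    (h : 2 * L * size x ≤ ∑ i, (m i x : ℝ) - ∑ i, (b i x : ℝ)) :
    sizeDrift b m (fun n => √n) x ≤ -L * √(size x) := by
  have hB : 0 ≤ ∑ i, (b i x : ℝ) := Finset.sum_nonneg fun i _ => (b i x).2
  set B := ∑ i, (b i x : ℝ)
  set M := ∑ i, (m i x : ℝ)
  obtain ⟨k, hk⟩ : ∃ k, size x = k + 1 := ⟨size x - 1, by omega⟩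
  rw [sizeDrift, hk, Nat.add_sub_cancel]
  rw [hk] at h
  push_cast at h ⊢
  change B * _ - M * _ ≤ _
  set a := √(k : ℝ) with ha
  set e := √((k : ℝ) + 1) with he
  set f := √((k : ℝ) + 1 + 1) with hf
  have ha2 : a ^ 2 = k := Real.sq_sqrt (by positivity)
  have he2 : e ^ 2 = k + 1 := Real.sq_sqrt (by positivity)
  have hf2 : f ^ 2 = k + 1 + 1 := Real.sq_sqrt (by positivity)
  have ha0 : 0 ≤ a := Real.sqrt_nonneg _
  have he0 : 0 < e := Real.sqrt_pos.2 (by positivity)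
  have hf0 : 0 ≤ f := Real.sqrt_nonneg _
  have hae : a ≤ e := Real.sqrt_le_sqrt (by linarith)
  have h1 : f - e ≤ e - a := by nlinarith [sq_nonneg (f - a)]
  have h2 : 1 ≤ 2 * e * (e - a) := by nlinarith
  have h3 : L * e * 1 ≤ L * e * (2 * e * (e - a)) := by gcongr
  have h4 : (e - a) * (2 * L * e ^ 2) ≤ (e - a) * (M - B) := by
    rw [he2]
    exact mul_le_mul_of_nonneg_left h (by linarith)
  have h5 : B * (f - e) ≤ B * (e - a) := mul_le_mul_of_nonneg_left h1 hB
  nlinarith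

/-- The drift of `exp(ε|x|)` is `-(1 - e^{-ε}) (M - e^ε B) exp(ε|x|)`, where `B` and `M` are the
total birth and death rates. -/
theorem sizeDrift_exp_le {x : Fin d → ℕ} (hx : 1 ≤ size x) {ε δ L : ℝ} (hε : 0 ≤ ε)
    (hδ : Real.exp ε ≤ δ)
    (h : L ≤ (1 - Real.exp (-ε)) * (∑ i, (m i x : ℝ) - δ * ∑ i, (b i x : ℝ))) :
    sizeDrift b m (fun n => Real.exp (ε * n)) x ≤ -L * Real.exp (ε * size x) := by
  have hB : 0 ≤ ∑ i, (b i x : ℝ) := Finset.sum_nonneg fun i _ => (b i x).2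
  have e1 : Real.exp (ε * (size x + 1 : ℕ)) = Real.exp (ε * size x) * Real.exp ε := by
    rw [← Real.exp_add]; push_cast; ring_nf
  have e2 : Real.exp (ε * (size x - 1 : ℕ)) = Real.exp (ε * size x) * Real.exp (-ε) := by
    rw [← Real.exp_add, Nat.cast_sub hx]; push_cast; ring_nf
  have e3 : Real.exp (-ε) * Real.exp ε = 1 := by rw [← Real.exp_add]; simp
  have e4 : Real.exp (-ε) ≤ 1 := Real.exp_le_one_iff.2 (by linarith)
  rw [sizeDrift, e1, e2]
  set B := ∑ i, (b i x : ℝ)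
  set M := ∑ i, (m i x : ℝ)
  have h1 : (1 - Real.exp (-ε)) * (M - δ * B) ≤ (1 - Real.exp (-ε)) * (M - Real.exp ε * B) := by
    have : 0 ≤ 1 - Real.exp (-ε) := by linarith
    gcongr
  have h2 : B * (Real.exp (ε * size x) * Real.exp ε - Real.exp (ε * size x)) -
      M * (Real.exp (ε * size x) - Real.exp (ε * size x) * Real.exp (-ε)) =
      -((1 - Real.exp (-ε)) * (M - Real.exp ε * B)) * Real.exp (ε * size x) := by
    linear_combination (B * Real.exp (ε * size x)) * e3
  rw [h2]
  have := h.trans h1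
  gcongr

theorem isLittleO_exp_mul {a c : ℝ} (h : a < c) :
    (fun n : ℕ => Real.exp (a * n)) =o[atTop] fun n : ℕ => Real.exp (c * n) := by
  rw [Real.isLittleO_exp_comp_exp_comp]
  have := tendsto_natCast_atTop_atTop (R := ℝ)
  simp_rw [← sub_mul]
  exact this.const_mul_atTop (sub_pos.2 h)

theorem isLittleO_sqrt_natCast :
    (fun n : ℕ => √(n : ℝ)) =o[atTop] fun n : ℕ => (n : ℝ) := by
  have := (Asymptotics.isLittleO_pow_pow_atTop_of_lt (𝕜 := ℝ) one_lt_two).comp_tendsto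
    (Real.tendsto_sqrt_atTop.comp (tendsto_natCast_atTop_atTop (R := ℝ)))
  simpa [Function.comp_def] using this

end BirthDeath

theorem mainTheorem4 (d : ℕ) (hd : 1 ≤ d)
    (b m : Fin d → (Fin d → ℕ) → ℝ≥0)
    (hb_pos : ∀ i x, x ≠ 0 → 0 < b i x)
    (hb_zero : ∀ i, b i 0 = 0)
    (hm_pos : ∀ i x, 1 ≤ x i → 0 < m i x)
    (hm_zero : ∀ i x, x i = 0 → m i x = 0) :
    -- first growth condition
    (Tendsto (fun x : Fin d → ℕ => 1 / (size x : ℝ) * ∑ i, ((m i x : ℝ) - (b i x : ℝ)))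
        (comap size atTop) atTop →
      AssumptionH (birthDeath b m) 0 ∧
      ∃ U : {x : Fin d → ℕ // x ≠ 0} → ℝ,
        InLocalExtendedDomain ((birthDeath b m).unkilled 0) (fun x => (size x.1 : ℝ)) U ∧
        LyapunovBound ((birthDeath b m).killing 0) (fun x => (size x.1 : ℝ)) U) ∧
    -- second growth condition
    (∀ δ : ℝ, 1 < δ →
      Tendsto (fun x : Fin d → ℕ => ∑ i, ((m i x : ℝ) - δ * (b i x : ℝ)))
        (comap size atTop) atTop →
      AssumptionH (birthDeath b m) 0 ∧
      ∃ ε₀ : ℝ, 0 < ε₀ ∧ ∀ ε : ℝ, 0 < ε → ε ≤ ε₀ →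
        ∃ U : {x : Fin d → ℕ // x ≠ 0} → ℝ,
          InExtendedDomain ((birthDeath b m).unkilled 0).law
            (fun x => Real.exp (ε * (size x.1 : ℝ))) U ∧
          LyapunovBound ((birthDeath b m).killing 0)
            (fun x => Real.exp (ε * (size x.1 : ℝ))) U) := by
  set lam : ℝ := ((⨆ x, (birthDeath b m).killing 0 x : ℝ≥0) : ℝ) + 1 with hlam_def
  have hlam : ((⨆ x, (birthDeath b m).killing 0 x : ℝ≥0) : ℝ) < lam := lt_add_one _
  have hlam0 : 0 ≤ lam := by positivity
  refine ⟨fun h => ?_, fun δ hδ h => ?_⟩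
  · obtain ⟨N₀, hN₀⟩ := eventually_comap_size.1 (h.eventually_ge_atTop (2 * lam))
    have hgrow : ∀ x : Fin d → ℕ, max N₀ 1 ≤ size x →
        1 ≤ size x ∧ 2 * lam * size x ≤ ∑ i, (m i x : ℝ) - ∑ i, (b i x : ℝ) := by
      intro x hx
      have hx1 : 1 ≤ size x := (le_max_right _ _).trans hx
      have hpos : (0 : ℝ) < size x := by exact_mod_cast hx1
      have := hN₀ x ((le_max_left _ _).trans hx)
      rw [Finset.sum_sub_distrib, one_div, inv_mul_eq_div, le_div_iff₀ hpos] at this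
      exact ⟨hx1, this⟩
    have hid : ∀ x : Fin d → ℕ, max N₀ 1 ≤ size x → ∀ c : ℝ,
        sizeDrift b m (fun n => (n : ℝ) + c) x ≤ -lam * size x := by
      intro x hx c
      obtain ⟨h1, h2⟩ := hgrow x hx
      rw [sizeDrift_natCast h1]
      have : 0 ≤ lam * size x := by positivity
      linarith
    have hid0 : ∀ x : Fin d → ℕ, max N₀ 1 ≤ size x → ∀ c : ℝ,
        sizeDrift b m (fun n => (n : ℝ) + c) x ≤ 0 := fun x hx c =>
      (hid x hx c).trans (by rw [neg_mul]; exact neg_nonpos.2 (by positivity))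
    have hid' : ∀ x : Fin d → ℕ, max N₀ 1 ≤ size x →
        sizeDrift b m (fun n => (n : ℝ)) x ≤ -lam * size x := fun x hx => by
      simpa using hid x hx 0
    have hid0' : ∀ x : Fin d → ℕ, max N₀ 1 ≤ size x →
        sizeDrift b m (fun n => (n : ℝ)) x ≤ 0 := fun x hx => by
      simpa using hid0 x hx 0
    have hsqrt : ∀ x : Fin d → ℕ, max N₀ 1 ≤ size x →
        sizeDrift b m (fun n => √(n : ℝ)) x ≤ -lam * √(size x) := fun x hx =>
      sizeDrift_sqrt_le (hgrow x hx).1 hlam0 (hgrow x hx).2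
    have hcast : ∀ n : ℕ, 1 ≤ n → (1 : ℝ) ≤ n := fun n hn => by exact_mod_cast hn
    have hsqrt1 : ∀ n : ℕ, 1 ≤ n → 1 ≤ √(n : ℝ) := fun n hn => Real.one_le_sqrt.2 (hcast n hn)
    have hnat := tendsto_natCast_atTop_atTop (R := ℝ)
    refine ⟨assumptionH_birthDeath hb_pos hb_zero hm_pos hm_zero
      (ψ := fun n => (n : ℝ) + 1) (fun n => by simp) (fun x hx => hid0 x hx 1)
      (tendsto_atTop_add_const_right _ _ hnat) ?_, ?_⟩
    -- In general `|x|` itself is only in the local domain; its square root is negligible with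
    -- respect to it and is in the domain.
    · exact ⟨_, _, unkilled_inExtendedDomain hm_zero (φ := fun n => √(n : ℝ))
        (ψ := fun n => (n : ℝ))
        (fun n => Real.sqrt_nonneg _) hsqrt1 (fun n => n.cast_nonneg) hcast
        (fun x hx => (hsqrt x hx).trans (by rw [neg_mul]; exact neg_nonpos.2 (by positivity)))
        hid0' isLittleO_sqrt_natCast,
        lyapunovBound_size hlam hsqrt hsqrt1 (Real.tendsto_sqrt_atTop.comp hnat)⟩
    · exact ⟨_, unkilled_inLocalExtendedDomain hm_zero,
        lyapunovBound_size (φ := fun n => (n : ℝ)) hlam hid' hcast hnat⟩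
  · have hlog : 0 < Real.log δ := Real.log_pos hδ
    -- For every `0 < ε ≤ log δ` the drift of `exp (ε |x|)` is eventually as negative as desired.
    have hexp : ∀ ε : ℝ, 0 < ε → ε ≤ Real.log δ → ∃ N, ∀ x : Fin d → ℕ, N ≤ size x →
        sizeDrift b m (fun n => Real.exp (ε * n)) x ≤ -lam * Real.exp (ε * size x) := by
      intro ε hε hεδ
      have hr : 0 < 1 - Real.exp (-ε) := by
        have : Real.exp (-ε) < 1 := Real.exp_lt_one_iff.2 (by linarith)
        linarith
      obtain ⟨N₀, hN₀⟩ := eventually_comap_size.1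
        (h.eventually_ge_atTop (lam / (1 - Real.exp (-ε))))
      refine ⟨max N₀ 1, fun x hx => sizeDrift_exp_le ((le_max_right _ _).trans hx) hε.le
        ((Real.le_log_iff_exp_le (by linarith)).1 hεδ) ?_⟩
      have := hN₀ x ((le_max_left _ _).trans hx)
      rw [Finset.sum_sub_distrib, ← Finset.mul_sum, div_le_iff₀ hr] at this
      linarith
    have hone : ∀ ε : ℝ, 0 < ε → ∀ n : ℕ, 1 ≤ Real.exp (ε * n) := fun ε hε n =>
      Real.one_le_exp (by positivity)
    have hnonpos : ∀ ε : ℝ, ∀ n : ℕ, -lam * Real.exp (ε * n) ≤ 0 := fun ε n => by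
      rw [neg_mul]
      exact neg_nonpos.2 (by positivity)
    have htend : ∀ ε : ℝ, 0 < ε → Tendsto (fun n : ℕ => Real.exp (ε * n)) atTop atTop :=
      fun ε hε => Real.tendsto_exp_atTop.comp (tendsto_natCast_atTop_atTop.const_mul_atTop hε)
    obtain ⟨N₁, hN₁⟩ := hexp (Real.log δ) hlog le_rfl
    have main : ∀ ε : ℝ, 0 < ε → ε ≤ Real.log δ / 2 →
        ∃ U : {x : Fin d → ℕ // x ≠ 0} → ℝ,
          InExtendedDomain ((birthDeath b m).unkilled 0).law
            (fun x => Real.exp (ε * (size x.1 : ℝ))) U ∧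
          LyapunovBound ((birthDeath b m).killing 0)
            (fun x => Real.exp (ε * (size x.1 : ℝ))) U := by
      intro ε hε hεδ
      obtain ⟨N, hN⟩ := hexp ε hε (by linarith)
      refine ⟨_, unkilled_inExtendedDomain hm_zero (φ := fun n => Real.exp (ε * n))
        (ψ := fun n => Real.exp (Real.log δ * n)) (N := max N N₁) (fun n => Real.exp_nonneg _)
        (fun n _ => hone ε hε n) (fun n => Real.exp_nonneg _) (fun n _ => hone _ hlog n)
        (fun x hx => (hN x ((le_max_left _ _).trans hx)).trans (hnonpos _ _))
        (fun x hx => (hN₁ x ((le_max_right _ _).trans hx)).trans (hnonpos _ _))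
        (isLittleO_exp_mul (by linarith)), ?_⟩
      exact lyapunovBound_size (φ := fun n => Real.exp (ε * n)) hlam hN (fun n _ => hone ε hε n)
        (htend ε hε)
    refine ⟨assumptionH_birthDeath hb_pos hb_zero hm_pos hm_zero (hone _ hlog)
      (fun x hx => (hN₁ x hx).trans (hnonpos _ _)) (htend _ hlog) ?_,
      Real.log δ / 2, half_pos hlog, main⟩
    obtain ⟨U, hU⟩ := main (Real.log δ / 2) (half_pos hlog) le_rfl
    exact ⟨_, U, hU⟩
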